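/- Let $\mathbb T^2=\mathbb R^2/\mathbb Z^2$ with its flat Euclidean distance $d$ and Lebesgue measure $\mu$, let $f:\mathbb T^2\to\mathbb T^2$ be Arnold's cat map, induced by $\left(\begin{smallmatrix}2&1\\1&1\end{smallmatrix}\right)$, and let $\lambda=\frac{3+\sqrt5}{2}$ be its unstable eigenvalue. Let $\varepsilon>0$ and, in orthonormal coordinates along the unstable and stable directions $E^u,E^s$ at the fixed point $0$ (projected to the torus), put $$\mathcal Z_1=(-\varepsilon,\varepsilon)\times\{0\},\qquad \mathcal Z_2=(\lambda\varepsilon,\lambda^2\varepsilon)\times\{0\}.$$ For $i=1,2$ let $\psi_i(x)=g_i(d(x,\mathcal Z_i))$, where $d(x,\mathcal Z)=\inf_{z\in\mathcal Z}d(x,z)$ and each $g_i:[0,\infty)\to(-\infty,+\infty]$ is of one of the forms $g_i(t)=-\log t$, $g_i(t)=t^{-1/\alpha_i}$ (both $+\infty$ at $0$), or $g_i(t)=D_i-t^{1/\alpha_i}$, with $\alpha_i>0$, $D_i\in\mathbb R$. Put $\Psi=(\psi_1,\psi_2)$, $X_n=\Psi\circ f^n$, and let $M_n$ be the componentwise maximum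 of $X_0,\dots,X_{n-1}$. Vectors are compared componentwise. Then $f$ preserves the probability measure $\mu$, $\Psi$ is measurable, and for every $\tau=(\tau_1,\tau_2)\in[0,\infty)^2\setminus\{(0,0)\}$ there are vectors $u_n=(u_{n1},u_{n2})\in\mathbb R^2$ with $$\lim_{n\to\infty}n\,\mu(\psi_j>u_{nj})=\tau_j,\qquad j=1,2.\tag{1}$$ Moreover, for every such $\tau$ and every sequence $(u_n)$ in $\mathbb R^2$ satisfying (1), writing $A_n^{(q)}=\{X_0\not\le u_n,\ X_1\le u_n,\dots,X_q\le u_n\}$ for $q\ge 0$ and $W_{s,\ell}(B)=\bigcap_{i=s}^{s+\ell-1}f^{-i}(B^c)$, the following hold. 1. $\lim_{n\to\infty} n\,\mu(X_0\not\le u_n)=\hat\Gamma(\tau):=\tau_1+\tau_2$. 2. There are $\gamma(q,n,t)\ge0$, nonincreasing in $t$, and for every $q\ge0$ integers $t_n=t_n^{(q)}\ge1$ with $t_n=o(n)$, such that for all $q\ge0$ and $n,t,\ell\ge1$ $$\left|\mu\big(A_n^{(q)}\cap W_{t,\ell}(A_n^{(q)})\big)-\mu\big(A_n^{(q)}\big)\,\mu\big(W_{0,\ell}(A_n^{(q)})\big)\right|\le\gamma(q,n,t),\qquad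 \lim_{q\to\infty}\limsup_{n\to\infty}n\,\gamma(q,n,t_n^{(q)})=0;$$ and for the same $t_n^{(q)}$ there are integers $k_n\to\infty$ with $k_nt_n^{(q)}=o(n)$ for every $q$ and $$\lim_{q\to\infty}\limsup_{n\to\infty}\,n\sum_{j=q+1}^{\lfloor n/k_n\rfloor-1}\mu\big(A_n^{(q)}\cap f^{-j}(A_n^{(q)})\big)=0.$$ 3. The limit $\theta(\tau)=\lim_{q\to\infty}\lim_{n\to\infty}\mu(A_n^{(q)})/\mu(A_n^{(0)})$ exists (the inner limit for every $q\ge0$) and, with $\alpha=\frac{\tau_1}{\tau_1+\tau_2}$, $$\theta(\tau)=\begin{cases}1-\dfrac{(1+\lambda^{-1})\alpha}{2}&\text{if }\alpha\le\dfrac{2\lambda}{3\lambda-1},\\[2mm]\dfrac{(\lambda-1)\alpha}{\lambda}&\text{if }\alpha>\dfrac{2\lambda}{3\lambda-1}.\end{cases}$$ 4. $\displaystyle\lim_{n\to\infty}\mu(M_n\le u_n)=e^{-\theta(\tau)\hat\Gamma(\tau)}$. -/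

import Mathlib

open MeasureTheory Filter Topology
open scoped ENNReal NNReal

namespace MultivariateExtremes

noncomputable section General

/-! Multivariate extremes of a process `Ψ, Ψ ∘ f, Ψ ∘ f², …` over a system `(𝒳, μ, f)`.
Vectors in `Fin d → EReal` are compared componentwise. -/

variable {𝒳 : Type*} {d : ℕ}

/-- The process `X n = Ψ ∘ f^n`, with values in the extended reals. -/
def process (f : 𝒳 → 𝒳) (Ψ : 𝒳 → Fin d → EReal) (n : ℕ) (x : 𝒳) : Fin d → EReal :=
  Ψ (f^[n] x)

/-- The componentwise maxima `M n = max (X 0, …, X (n - 1))`, with `M 0 = -∞`. -/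
def maxima (f : 𝒳 → 𝒳) (Ψ : 𝒳 → Fin d → EReal) (n : ℕ) (x : 𝒳) : Fin d → EReal :=
  fun j => (Finset.range n).sup fun i => process f Ψ i x j

/-- A real vector seen as a vector of extended reals. -/
def toEVec (v : Fin d → ℝ) : Fin d → EReal := fun j => (v j : EReal)

/-- The event `{M n ≤ v}`. -/
def maxLE (f : 𝒳 → 𝒳) (Ψ : 𝒳 → Fin d → EReal) (n : ℕ) (v : Fin d → ℝ) : Set 𝒳 :=
  {x | maxima f Ψ n x ≤ toEVec v}

/-- The event `{X 0 ≰ v}`: at least one component of `Ψ` exceeds its level. -/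
def exceed (f : 𝒳 → 𝒳) (Ψ : 𝒳 → Fin d → EReal) (v : Fin d → ℝ) : Set 𝒳 :=
  {x | ¬ process f Ψ 0 x ≤ toEVec v}

/-- The event `A^(q) = {X 0 ≰ v, X 1 ≤ v, …, X q ≤ v} = {X 0 ≰ v} ∩ f⁻¹ {M q ≤ v}`.
For `q = 0` it is `{X 0 ≰ v}`. -/
def clusterEnd (f : 𝒳 → 𝒳) (Ψ : 𝒳 → Fin d → EReal) (q : ℕ) (v : Fin d → ℝ) : Set 𝒳 :=
  exceed f Ψ v ∩ f ⁻¹' maxLE f Ψ q v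

/-- `W_{s,ℓ}(B) = ⋂_{i = s}^{s + max (ℓ - 1) 0} f^{-i}(Bᶜ)` (the subtraction is truncated). -/
def avoid (f : 𝒳 → 𝒳) (s ℓ : ℕ) (B : Set 𝒳) : Set 𝒳 :=
  ⋂ i ∈ Finset.Icc s (s + (ℓ - 1)), f^[i] ⁻¹' Bᶜ

variable [MeasurableSpace 𝒳]

/-- `n μ(ψ_j > u_{nj}) → τ_j` for every component `j`. -/
def IsNormalising (μ : Measure 𝒳) (Ψ : 𝒳 → Fin d → EReal) (τ : Fin d → ℝ)
    (u : ℕ → Fin d → ℝ) : Prop :=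
  ∀ j, Tendsto (fun n : ℕ => (n : ℝ) * μ.real {x | (u n j : EReal) < Ψ x j}) atTop (𝓝 (τ j))

/-- `n μ(X 0 ≰ u_n) → Γ`. -/
def HasTailLimit (μ : Measure 𝒳) (f : 𝒳 → 𝒳) (Ψ : 𝒳 → Fin d → EReal)
    (u : ℕ → Fin d → ℝ) (Γ : ℝ) : Prop :=
  Tendsto (fun n : ℕ => (n : ℝ) * μ.real (exceed f Ψ (u n))) atTop (𝓝 Γ)

/-- The mixing condition `Д(u_n)`, with the gap sequences `t q = (t_n)_n`, one for each `q`. -/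
def MixingCondition (μ : Measure 𝒳) (f : 𝒳 → 𝒳) (Ψ : 𝒳 → Fin d → EReal)
    (u : ℕ → Fin d → ℝ) (t : ℕ → ℕ → ℕ) : Prop :=
  ∃ γ : ℕ → ℕ → ℕ → ℝ≥0,
    (∀ q n, Antitone (γ q n)) ∧
    (∀ q n s ℓ : ℕ, 1 ≤ n → 1 ≤ s → 1 ≤ ℓ →
      |μ.real (clusterEnd f Ψ q (u n) ∩ avoid f s ℓ (clusterEnd f Ψ q (u n)))
        - μ.real (clusterEnd f Ψ q (u n)) * μ.real (avoid f 0 ℓ (clusterEnd f Ψ q (u n)))|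
        ≤ (γ q n s : ℝ)) ∧
    (∀ q n, 1 ≤ t q n) ∧
    (∀ q, Tendsto (fun n : ℕ => (t q n : ℝ) / (n : ℝ)) atTop (𝓝 0)) ∧
    Tendsto (fun q : ℕ => limsup (fun n : ℕ => (n : ℝ≥0∞) * (γ q n (t q n) : ℝ≥0∞)) atTop)
      atTop (𝓝 0)

/-- The cluster separation condition `Д'(u_n)`, relative to the gap sequences `t`. -/
def SeparationCondition (μ : Measure 𝒳) (f : 𝒳 → 𝒳) (Ψ : 𝒳 → Fin d → EReal)
    (u : ℕ → Fin d → ℝ) (t : ℕ → ℕ → ℕ) : Prop :=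
  ∃ k : ℕ → ℕ,
    Tendsto k atTop atTop ∧
    (∀ q, Tendsto (fun n : ℕ => (k n : ℝ) * (t q n : ℝ) / (n : ℝ)) atTop (𝓝 0)) ∧
    Tendsto (fun q : ℕ => limsup (fun n : ℕ =>
        (n : ℝ≥0∞) * ∑ j ∈ Finset.Ico (q + 1) (n / k n),
          μ (clusterEnd f Ψ q (u n) ∩ f^[j] ⁻¹' clusterEnd f Ψ q (u n))) atTop)
      atTop (𝓝 0)

/-- The iterated limit `lim_q lim_n μ(A_n^(q)) / μ(A_n^(0))` exists (the inner limit for every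
`q`) and equals `θ`. -/
def HasExtremalIndex (μ : Measure 𝒳) (f : 𝒳 → 𝒳) (Ψ : 𝒳 → Fin d → EReal)
    (u : ℕ → Fin d → ℝ) (θ : ℝ) : Prop :=
  ∃ ϑ : ℕ → ℝ,
    (∀ q, Tendsto (fun n : ℕ => μ.real (clusterEnd f Ψ q (u n)) / μ.real (clusterEnd f Ψ 0 (u n)))
      atTop (𝓝 (ϑ q))) ∧
    Tendsto ϑ atTop (𝓝 θ)

end General

noncomputable section

/-- The observable shape `g(t) = -log t`, with `g(0) = +∞`. -/
def shapeLog (t : ℝ) : EReal := -ENNReal.log (ENNReal.ofReal t)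

/-- The observable shape `g(t) = t^(-1/α)`, with `g(0) = +∞`. -/
def shapePower (α t : ℝ) : EReal := ((ENNReal.ofReal t ^ (-(1 / α)) : ℝ≥0∞) : EReal)

/-- The observable shape `g(t) = D - t^(1/α)`. -/
def shapeBounded (D α t : ℝ) : EReal := ((D - t ^ (1 / α) : ℝ) : EReal)

/-- The three types of observable shapes on `[0, ∞)`. -/
def IsShape (g : ℝ → EReal) : Prop :=
  g = shapeLog ∨ (∃ α : ℝ, 0 < α ∧ g = shapePower α) ∨
    ∃ D α : ℝ, 0 < α ∧ g = shapeBounded D α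

/-- The torus `𝕋² = ℝ²/ℤ²`; its `volume` is Lebesgue measure. -/
abbrev Torus : Type := UnitAddCircle × UnitAddCircle

/-- Arnold's cat map, induced by the matrix with rows `(2, 1)` and `(1, 1)`. -/
def catMap (p : Torus) : Torus := (2 • p.1 + p.2, p.1 + p.2)

/-- The flat Euclidean distance of `ℝ²/ℤ²`. -/
def flatDist (p p' : Torus) : ℝ := √(dist p.1 p'.1 ^ 2 + dist p.2 p'.2 ^ 2)

/-- The distance `d(p, Z) = inf_{z ∈ Z} d(p, z)`. -/
def distTo (p : Torus) (Z : Set Torus) : ℝ := sInf (flatDist p '' Z)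

/-- The unstable eigenvalue `(3 + √5)/2` of the cat map. -/
def lam : ℝ := (3 + √5) / 2

/-- The point with coordinates `(s, 0)` in the axes `E^u, E^s` at the fixed point `0`, that is,
the class of `s • e` where `e` is the unit eigenvector `(lam - 1, 1) / |(lam - 1, 1)|`. -/
def unstablePoint (s : ℝ) : Torus :=
  (((s * ((lam - 1) / √((lam - 1) ^ 2 + 1)) : ℝ) : UnitAddCircle),
    ((s * (1 / √((lam - 1) ^ 2 + 1)) : ℝ) : UnitAddCircle))

/-- The extremal sets `Z_1 = (-ε, ε) × {0}` (index `0`) and `Z_2 = (lam ε, lam² ε) × {0}`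
(index `1`), in the axes `E^u, E^s`. -/
def extremalSet (ε : ℝ) : Fin 2 → Set Torus :=
  ![unstablePoint '' Set.Ioo (-ε) ε, unstablePoint '' Set.Ioo (lam * ε) (lam ^ 2 * ε)]

/-- The observable `Ψ = (ψ_1, ψ_2)` with `ψ_i(x) = g_i(d(x, Z_i))`. -/
def observable (ε : ℝ) (g : Fin 2 → ℝ → EReal) (p : Torus) : Fin 2 → EReal :=
  fun i => g i (distTo p (extremalSet ε i))

/-- `Γ̂(τ) = τ_1 + τ_2`. -/
def gammaHat (τ : Fin 2 → ℝ) : ℝ := τ 0 + τ 1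

/-- The extremal index function of the cat map example, with `α = τ_1 / (τ_1 + τ_2)`. -/
def theta (τ : Fin 2 → ℝ) : ℝ :=
  if τ 0 / (τ 0 + τ 1) ≤ 2 * lam / (3 * lam - 1) then
    1 - (1 + lam⁻¹) * (τ 0 / (τ 0 + τ 1)) / 2
  else (lam - 1) * (τ 0 / (τ 0 + τ 1)) / lam

end

end MultivariateExtremes

open MultivariateExtremes

namespace MultivariateExtremes

noncomputable section

/-! ### The eigenbasis of the cat map -/

/-! In the axes `E^u, E^s` the cat map lifts to `(x, y) ↦ (lam x, y / lam)`. Each shape is strictly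
decreasing wherever it is used, so `{X 0 ≰ u_n}` is a union of neighbourhoods of the two segments
with radii `r₁, r₂`. Their areas are, to first order, the radii times twice the lengths of the
segments. Hence (1) says that `n r_i` tends to `τ_i / segWeight ε i` (`exists_radii`), and
everything becomes a statement about radii of order `1 / n`.

Arithmetic controls the sheets of the covering. In eigencoordinates a lattice vector has `x y` equal
to a constant times the integer `b² + ab - a²`, which vanishes only at the origin; so `|x| |y|` is
bounded below off the origin (`latticeGap_le`). For fixed `q` and thin neighbourhoods, every return
up to time `q` is therefore a return of the linear flow, and `A^(q)` has the area of an explicit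
union of boxes up to `O(r²)` (`abs_measureReal_clusterSet_sub_le`). In the first box, points with
`|x| < ε / lam` return at once and those with `x < -ε / lam` leave for good. Those with `x ≥ ε /
lam` jump over the gap and meet the second strip at time 2 exactly when `|y| < lam² r₂`; points of
the second box never return. The maximum of `r₁ - lam² r₂` and `0` in the resulting area produces
the two cases of `theta`.

Two estimates give the dependence conditions. A set of finite perimeter decorrelates exponentially
from its own future (`abs_measureReal_inter_preimage_sub_le`): average over translates by `f^{-m}
y`, let the set absorb the contracted unstable part, and let the future absorb the stable part. For
`q ≥ 3`, a return of `A^(q)` to itself must change sheet, and such returns have measure `O(r²)`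
uniformly in time (`measureReal_clusterSet_inter_preimage_le`). Together they make the probability
of no visit to `A^(q)` close to `(1 - μ A^(q))^n` (`abs_measureReal_sub_pow_le`). Avoiding `A^(q)`
instead of the whole exceedance set costs at most `q` times the measure of the latter. -/

lemma lam_sq : lam ^ 2 = 3 * lam - 1 := by
  have h : √5 ^ 2 = (5 : ℝ) := Real.sq_sqrt (by norm_num)
  unfold lam
  linear_combination h / 4

lemma two_lt_lam : 2 < lam := by
  have h : 2 < √5 := Real.lt_sqrt_of_sq_lt (by norm_num)
  unfold lam
  linarith

lemma lam_pos : 0 < lam := by linarith [two_lt_lam]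

lemma lam_inv : lam⁻¹ = 3 - lam :=
  inv_eq_of_mul_eq_one_right (by linear_combination -lam_sq)

/-- First coordinate of the unit unstable vector. -/
def eCos : ℝ := (lam - 1) / √((lam - 1) ^ 2 + 1)

/-- Second coordinate of the unit unstable vector. -/
def eSin : ℝ := 1 / √((lam - 1) ^ 2 + 1)

lemma eSin_pos : 0 < eSin := by unfold eSin; positivity

lemma eCos_eq : eCos = (lam - 1) * eSin := by unfold eCos eSin; ring

lemma eCos_pos : 0 < eCos := by
  rw [eCos_eq]
  exact mul_pos (by linarith [two_lt_lam]) eSin_pos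

lemma eCos_sq_add_eSin_sq : eCos ^ 2 + eSin ^ 2 = 1 := by
  have h : 0 < (lam - 1) ^ 2 + 1 := by positivity
  unfold eCos eSin
  rw [div_pow, div_pow, Real.sq_sqrt h.le]
  field_simp

/-- The covering map from the plane with axes `E^u, E^s` to the torus. -/
def axes : ℝ × ℝ →+ Torus where
  toFun w := (((w.1 * eCos - w.2 * eSin : ℝ) : UnitAddCircle),
    ((w.1 * eSin + w.2 * eCos : ℝ) : UnitAddCircle))
  map_zero' := by simp
  map_add' w w' := by
    ext
    · simp only [Prod.fst_add, Prod.snd_add]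
      rw [← AddCircle.coe_add]
      congr 1; ring
    · simp only [Prod.fst_add, Prod.snd_add]
      rw [← AddCircle.coe_add]
      congr 1; ring

lemma axes_apply (w : ℝ × ℝ) : axes w = (((w.1 * eCos - w.2 * eSin : ℝ) : UnitAddCircle),
    ((w.1 * eSin + w.2 * eCos : ℝ) : UnitAddCircle)) := rfl

lemma unstablePoint_eq (s : ℝ) : unstablePoint s = axes (s, 0) := by
  simp [unstablePoint, axes_apply, eCos, eSin]

/-- The cat map as a homomorphism. -/
def catHom : Torus →+ Torus where
  toFun := catMap
  map_zero' := by simp [catMap]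
  map_add' p p' := by
    ext
    · simp only [catMap, Prod.fst_add, Prod.snd_add]; abel
    · simp only [catMap, Prod.fst_add, Prod.snd_add]; abel

lemma catMap_add (p p' : Torus) : catMap (p + p') = catMap p + catMap p' := map_add catHom p p'

lemma catMap_iterate_add (n : ℕ) (p p' : Torus) :
    catMap^[n] (p + p') = catMap^[n] p + catMap^[n] p' := by
  induction n generalizing p p' with
  | zero => rfl
  | succ n ih => simp only [Function.iterate_succ_apply, catMap_add, ih]

lemma catMap_axes (w : ℝ × ℝ) : catMap (axes w) = axes (lam * w.1, lam⁻¹ * w.2) := by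
  have h := lam_sq
  rw [axes_apply, axes_apply, catMap, lam_inv, eCos_eq, ← AddCircle.coe_nsmul,
    ← AddCircle.coe_add, ← AddCircle.coe_add]
  ext
  · dsimp only
    congr 1
    simp only [nsmul_eq_mul, Nat.cast_ofNat]
    linear_combination -w.1 * eSin * h
  · dsimp only
    congr 1
    linear_combination w.2 * eSin * h

lemma catMap_iterate_axes (n : ℕ) (w : ℝ × ℝ) :
    catMap^[n] (axes w) = axes (lam ^ n * w.1, (lam ^ n)⁻¹ * w.2) := by
  induction n generalizing w with
  | zero => simp
  | succ n ih =>
    rw [Function.iterate_succ_apply, catMap_axes, ih]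
    simp only [pow_succ, mul_inv, mul_assoc]

/-- The inverse of the cat map. -/
def catInv (p : Torus) : Torus := (p.1 - p.2, 2 • p.2 - p.1)

lemma catMap_catInv (p : Torus) : catMap (catInv p) = p := by
  ext
  · simp only [catMap, catInv]; abel
  · simp only [catMap, catInv]; abel

lemma catInv_catMap (p : Torus) : catInv (catMap p) = p := by
  ext
  · simp only [catMap, catInv]; abel
  · simp only [catMap, catInv]; abel

lemma continuous_catMap : Continuous catMap := by unfold catMap; fun_prop

lemma continuous_catInv : Continuous catInv := by unfold catInv; fun_prop

instance : IsProbabilityMeasure (volume : Measure UnitAddCircle) := ⟨UnitAddCircle.measure_univ⟩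

instance : IsProbabilityMeasure (volume : Measure Torus) :=
  inferInstanceAs (IsProbabilityMeasure
    ((volume : Measure UnitAddCircle).prod (volume : Measure UnitAddCircle)))

instance : (volume : Measure Torus).IsAddHaarMeasure :=
  inferInstanceAs (Measure.IsAddHaarMeasure
    ((volume : Measure UnitAddCircle).prod (volume : Measure UnitAddCircle)))

lemma measurePreserving_catMap : MeasurePreserving catMap (volume : Measure Torus) volume :=
  AddMonoidHom.measurePreserving (f := catHom) continuous_catMap
    (fun p => ⟨catInv p, catMap_catInv p⟩) rfl

lemma measurePreserving_catInv : MeasurePreserving catInv (volume : Measure Torus) volume where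
  measurable := continuous_catInv.measurable
  map_eq := by
    conv_lhs => rw [← measurePreserving_catMap.map_eq]
    rw [Measure.map_map continuous_catInv.measurable continuous_catMap.measurable]
    have : catInv ∘ catMap = id := funext catInv_catMap
    rw [this, Measure.map_id]

lemma catInv_iterate_axes (n : ℕ) (w : ℝ × ℝ) :
    catInv^[n] (axes w) = axes ((lam ^ n)⁻¹ * w.1, lam ^ n * w.2) := by
  have h : axes w = catMap^[n] (axes ((lam ^ n)⁻¹ * w.1, lam ^ n * w.2)) := by
    have := (pow_pos lam_pos n).ne'
    rw [catMap_iterate_axes]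
    congr 1
    ext <;> simp [this]
  rw [h, Function.LeftInverse.iterate catInv_catMap n]

/-! ### Separation of the sheets of the covering -/

lemma axes_eq_zero {w : ℝ × ℝ} (h : axes w = 0) :
    ∃ a b : ℤ, w.1 * eCos - w.2 * eSin = a ∧ w.1 * eSin + w.2 * eCos = b := by
  rw [axes_apply, Prod.mk_eq_zero, AddCircle.coe_eq_zero_iff, AddCircle.coe_eq_zero_iff] at h
  obtain ⟨⟨a, ha⟩, b, hb⟩ := h
  exact ⟨a, b, by simpa using ha.symm, by simpa using hb.symm⟩

/-- Four times the form is `(2b + a)² - 5a²`, a norm from `ℤ[√5]`, which is anisotropic because 5 is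
not a square. -/
lemma quadForm_ne_zero {a b : ℤ} (h : b ^ 2 + a * b - a ^ 2 = 0) : a = 0 ∧ b = 0 := by
  have h5 : ∀ n : ℤ, (5 : ℤ) ≠ n * n := by
    intro n hn
    have h1 : n.natAbs * n.natAbs = 5 := by
      zify; rw [abs_mul_abs_self]; exact hn.symm
    have h2 : n.natAbs < 3 := by nlinarith
    interval_cases n.natAbs <;> omega
  have := (Zsqrtd.norm_eq_zero h5 ⟨2 * b + a, a⟩).1 (by
    rw [Zsqrtd.norm_def]; linear_combination 4 * h)
  have h1 := congrArg Zsqrtd.re this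
  have h2 := congrArg Zsqrtd.im this
  simp only [Zsqrtd.re_zero, Zsqrtd.im_zero] at h1 h2
  omega

/-- A nonzero vector of the lattice `axes.ker` has product of coordinates at least this. -/
def latticeGap : ℝ := eCos * eSin

lemma latticeGap_pos : 0 < latticeGap := mul_pos eCos_pos eSin_pos

/-- The eigendirections have quadratic irrational slope, hence are badly approximable: the product
of coordinates is `eCos * eSin` times a nonzero integer value of the quadratic form. -/
lemma latticeGap_le {w : ℝ × ℝ} (h : axes w = 0) (hw : w ≠ 0) :
    latticeGap ≤ |w.1| * |w.2| := by
  obtain ⟨a, b, ha, hb⟩ := axes_eq_zero h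
  have h1 := eCos_sq_add_eSin_sq
  have hx : w.1 = a * eCos + b * eSin := by
    rw [← ha, ← hb]; linear_combination -w.1 * h1
  have hy : w.2 = b * eCos - a * eSin := by
    rw [← ha, ← hb]; linear_combination -w.2 * h1
  have hq : w.1 * w.2 = latticeGap * ((b ^ 2 + a * b - a ^ 2 : ℤ) : ℝ) := by
    rw [hx, hy, latticeGap]
    push_cast
    have h3 := eCos_eq
    have h4 : eCos ^ 2 - eSin ^ 2 = eCos * eSin := by
      rw [eCos_eq]; linear_combination eSin ^ 2 * lam_sq
    linear_combination (a * b : ℝ) * h4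
  rw [← abs_mul, hq, abs_mul, abs_of_pos latticeGap_pos]
  have hne : b ^ 2 + a * b - a ^ 2 ≠ 0 := by
    intro h0
    obtain ⟨rfl, rfl⟩ := quadForm_ne_zero h0
    apply hw
    ext
    · simpa using hx
    · simpa using hy
  have : (1 : ℝ) ≤ |((b ^ 2 + a * b - a ^ 2 : ℤ) : ℝ)| := by
    rw [← Int.cast_abs]; exact_mod_cast Int.one_le_abs hne
  nlinarith [latticeGap_pos]

lemma latticeGap_le_of_ne {w w' : ℝ × ℝ} (h : axes w = axes w') (hw : w ≠ w') :
    latticeGap ≤ |w.1 - w'.1| * |w.2 - w'.2| :=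
  latticeGap_le (w := w - w') (by rw [map_sub, h, sub_self]) (sub_ne_zero.2 hw)

end

noncomputable section

/-! ### Lebesgue measure on the torus and on the plane -/

/-- The half-open unit square. -/
def unitSquare : Set (ℝ × ℝ) := Set.Ioc 0 1 ×ˢ Set.Ioc 0 1

/-- An integer vector as a real vector. -/
def intVec (k : ℤ × ℤ) : ℝ × ℝ := (k.1, k.2)

/-- The covering map of the torus in standard coordinates. -/
def stdCover (w : ℝ × ℝ) : Torus := ((w.1 : UnitAddCircle), (w.2 : UnitAddCircle))

lemma stdCover_add_intVec (w : ℝ × ℝ) (k : ℤ × ℤ) : stdCover (w + intVec k) = stdCover w := by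
  simp only [stdCover, intVec, Prod.fst_add, Prod.snd_add, AddCircle.coe_add]
  have h (n : ℤ) : ((n : ℝ) : UnitAddCircle) = 0 :=
    (AddCircle.coe_eq_zero_iff 1).2 ⟨n, by simp⟩
  simp [h]

lemma exists_add_intVec {w w' : ℝ × ℝ} (h : stdCover w = stdCover w') :
    ∃ k, w = w' + intVec k := by
  have hone {x y : ℝ} (h : (x : UnitAddCircle) = y) : ∃ n : ℤ, x = y + n := by
    rw [← sub_eq_zero, ← AddCircle.coe_sub, AddCircle.coe_eq_zero_iff] at h
    obtain ⟨n, hn⟩ := h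
    exact ⟨n, by simp at hn; linarith⟩
  obtain ⟨a, ha⟩ := hone (congrArg Prod.fst h)
  obtain ⟨b, hb⟩ := hone (congrArg Prod.snd h)
  exact ⟨(a, b), Prod.ext ha hb⟩

lemma measurePreserving_stdCover :
    MeasurePreserving stdCover ((volume : Measure (ℝ × ℝ)).restrict unitSquare) volume := by
  have h := UnitAddCircle.measurePreserving_mk 0
  rw [zero_add] at h
  have h2 := h.prod h
  rw [Measure.prod_restrict] at h2
  exact h2

lemma measurableSet_unitSquare : MeasurableSet unitSquare :=
  measurableSet_Ioc.prod measurableSet_Ioc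

/-- The translates of the unit square tile the plane, and the half-open convention makes the tile of
a point readable from the ceilings of its coordinates. -/
lemma tsum_volume_translates {E : Set (ℝ × ℝ)} (hE : MeasurableSet E) :
    ∑' k : ℤ × ℤ, volume ((· + intVec k) ⁻¹' E ∩ unitSquare) = volume E := by
  have h1 (k : ℤ × ℤ) : volume ((· + intVec k) ⁻¹' E ∩ unitSquare)
      = volume (E ∩ (fun w : ℝ × ℝ => (⌈w.1⌉ - 1, ⌈w.2⌉ - 1)) ⁻¹' {k}) := by
    rw [← measure_preimage_add_right volume (intVec k) (E ∩ _)]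
    congr 1
    ext w
    simp only [Set.mem_inter_iff, Set.mem_preimage, unitSquare, Set.mem_prod, Set.mem_Ioc,
      Set.mem_singleton_iff, intVec, Prod.fst_add, Prod.snd_add, Int.ceil_add_intCast, Prod.ext_iff]
    have hc (x : ℝ) (n : ℤ) : (0 < x ∧ x ≤ 1) ↔ ⌈x⌉ + n - 1 = n := by
      have : ⌈x⌉ + n - 1 = n ↔ ⌈x⌉ = 1 := by omega
      rw [this, Int.ceil_eq_iff]; norm_num
    rw [hc w.1 k.1, hc w.2 k.2]
  have hm : Measurable (fun w : ℝ × ℝ => ((⌈w.1⌉ - 1, ⌈w.2⌉ - 1) : ℤ × ℤ)) :=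
    ((Int.measurable_ceil.comp measurable_fst).sub_const 1).prodMk
      ((Int.measurable_ceil.comp measurable_snd).sub_const 1)
  simp_rw [h1]
  rw [← measure_iUnion]
  · congr 1
    ext w; simp
  · intro k k' hk
    refine Set.disjoint_left.2 fun w hw hw' => hk ?_
    exact hw.2.symm.trans hw'.2
  · exact fun k => hE.inter (hm (measurableSet_singleton k))

/-- Areas on the torus are compared with areas in the plane from above by covering and, in the next
lemma, from below by injectivity; no exact formula for the image of a measure is needed. -/
lemma volume_le_of_subset_image_stdCover {V : Set Torus} {E : Set (ℝ × ℝ)}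
    (hV : MeasurableSet V) (hE : MeasurableSet E) (h : V ⊆ stdCover '' E) :
    volume V ≤ volume E := by
  rw [← measurePreserving_stdCover.measure_preimage hV.nullMeasurableSet,
    Measure.restrict_apply' measurableSet_unitSquare, ← tsum_volume_translates hE]
  refine (measure_mono ?_).trans (measure_iUnion_le _)
  rintro w ⟨hw, hQ⟩
  obtain ⟨w', hw', heq⟩ := h hw
  obtain ⟨k, rfl⟩ := exists_add_intVec heq
  exact Set.mem_iUnion.2 ⟨k, hw', hQ⟩

lemma volume_le_of_image_stdCover_subset {V : Set Torus} {E : Set (ℝ × ℝ)}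
    (hV : MeasurableSet V) (hE : MeasurableSet E) (h : stdCover '' E ⊆ V)
    (hinj : Set.InjOn stdCover E) :
    volume E ≤ volume V := by
  rw [← measurePreserving_stdCover.measure_preimage hV.nullMeasurableSet,
    Measure.restrict_apply' measurableSet_unitSquare, ← tsum_volume_translates hE,
    ← measure_iUnion]
  · refine measure_mono (Set.iUnion_subset fun k => ?_)
    rintro w ⟨hw, hQ⟩
    refine ⟨?_, hQ⟩
    have := h (Set.mem_image_of_mem _ hw)
    rwa [stdCover_add_intVec] at this
  · intro k k' hk
    refine Set.disjoint_left.2 fun w hw hw' => hk ?_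
    have := hinj hw.1 hw'.1 (by simp only [stdCover_add_intVec])
    have := add_left_cancel this
    simp only [intVec, Prod.mk.injEq, Int.cast_inj] at this
    exact Prod.ext this.1 this.2
  · exact fun k => ((measurable_add_const _) hE).inter measurableSet_unitSquare

/-- The rotation of the plane taking the standard axes to the axes `E^u, E^s`. -/
def rot : ℝ × ℝ →ₗ[ℝ] ℝ × ℝ :=
  Matrix.toLin (Module.Basis.finTwoProd ℝ) (Module.Basis.finTwoProd ℝ) !![eCos, -eSin; eSin, eCos]

lemma rot_apply (w : ℝ × ℝ) : rot w = (w.1 * eCos - w.2 * eSin, w.1 * eSin + w.2 * eCos) := by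
  rw [rot, Matrix.toLin_finTwoProd_apply]
  ext <;> simp <;> ring

lemma det_rot : LinearMap.det rot = 1 := by
  rw [rot, LinearMap.det_toLin, Matrix.det_fin_two_of]
  linear_combination eCos_sq_add_eSin_sq

lemma axes_eq_stdCover (w : ℝ × ℝ) : axes w = stdCover (rot w) := by
  rw [rot_apply]; rfl

lemma volume_rot_image (E : Set (ℝ × ℝ)) : volume (rot '' E) = volume E := by
  rw [Measure.addHaar_image_linearMap, det_rot]; simp

lemma measurableSet_rot_image {E : Set (ℝ × ℝ)} (hE : MeasurableSet E) :
    MeasurableSet (rot '' E) := by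
  have hdet : LinearMap.det rot ≠ 0 := by rw [det_rot]; exact one_ne_zero
  exact (rot.equivOfDetNeZero hdet).toContinuousLinearEquiv.toHomeomorph.toMeasurableEquiv
    |>.measurableSet_image.2 hE

lemma axes_image (E : Set (ℝ × ℝ)) : axes '' E = stdCover '' (rot '' E) := by
  rw [Set.image_image]
  exact Set.image_congr fun w _ => axes_eq_stdCover w

lemma volume_le_of_subset_image_axes {V : Set Torus} {E : Set (ℝ × ℝ)}
    (hV : MeasurableSet V) (hE : MeasurableSet E) (h : V ⊆ axes '' E) :
    volume V ≤ volume E := by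
  rw [← volume_rot_image E]
  exact volume_le_of_subset_image_stdCover hV (measurableSet_rot_image hE) (axes_image E ▸ h)

lemma volume_le_of_image_axes_subset {V : Set Torus} {E : Set (ℝ × ℝ)}
    (hV : MeasurableSet V) (hE : MeasurableSet E) (h : axes '' E ⊆ V)
    (hinj : Set.InjOn axes E) :
    volume E ≤ volume V := by
  rw [← volume_rot_image E]
  refine volume_le_of_image_stdCover_subset hV (measurableSet_rot_image hE) (axes_image E ▸ h) ?_
  rintro _ ⟨w, hw, rfl⟩ _ ⟨w', hw', rfl⟩ heq
  rw [← axes_eq_stdCover, ← axes_eq_stdCover] at heq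
  rw [hinj hw hw' heq]

/-- Every point of the torus has a lift in a fixed bounded region. -/
lemma exists_axes_eq (p : Torus) : ∃ w : ℝ × ℝ, axes w = p ∧ |w.1| ≤ 2 ∧ |w.2| ≤ 2 := by
  have hone (x : UnitAddCircle) : ∃ a : ℝ, (a : UnitAddCircle) = x ∧ |a| ≤ 1 := by
    obtain ⟨⟨a, ha⟩, h⟩ := (AddCircle.equivIoc (1 : ℝ) 0).symm.surjective x
    rw [zero_add] at ha
    exact ⟨a, h, abs_le.2 ⟨by linarith [ha.1], ha.2⟩⟩
  obtain ⟨a, ha, ha1⟩ := hone p.1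
  obtain ⟨b, hb, hb1⟩ := hone p.2
  have h1 := eCos_sq_add_eSin_sq
  have hc : |eCos| ≤ 1 := by
    rw [abs_of_pos eCos_pos]; nlinarith [sq_nonneg eSin, eCos_pos]
  have hs : |eSin| ≤ 1 := by
    rw [abs_of_pos eSin_pos]; nlinarith [sq_nonneg eCos, eSin_pos]
  have hm {x y : ℝ} (hx : |x| ≤ 1) (hy : |y| ≤ 1) : |x * y| ≤ 1 := by
    rw [abs_mul]; exact mul_le_one₀ hx (abs_nonneg _) hy
  refine ⟨(a * eCos + b * eSin, b * eCos - a * eSin), ?_, ?_, ?_⟩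
  · rw [axes_apply]
    ext
    · rw [← ha]; dsimp only; congr 1; linear_combination a * h1
    · rw [← hb]; dsimp only; congr 1; linear_combination b * h1
  · exact (abs_add_le _ _).trans (by linarith [hm ha1 hc, hm hb1 hs])
  · exact (abs_sub _ _).trans (by linarith [hm ha1 hs, hm hb1 hc])

end

noncomputable section

/-! ### Mixing of the cat map -/

/-- The measure of the symmetric difference of a set and its translate. -/
def shiftDefect (B : Set Torus) (c : Torus) : ℝ :=
  (volume : Measure Torus).real (symmDiff ((· + c) ⁻¹' B) B)

lemma shiftDefect_compl (B : Set Torus) (c : Torus) : shiftDefect Bᶜ c = shiftDefect B c := by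
  unfold shiftDefect
  rw [Set.preimage_compl, compl_symmDiff_compl]

lemma shiftDefect_inter_le (B B' : Set Torus) (c : Torus) :
    shiftDefect (B ∩ B') c ≤ shiftDefect B c + shiftDefect B' c := by
  refine (measureReal_mono ?_).trans (measureReal_union_le _ _)
  intro x
  simp only [Set.mem_symmDiff, Set.mem_preimage, Set.mem_inter_iff, Set.mem_union]
  tauto

lemma shiftDefect_union_le (B B' : Set Torus) (c : Torus) :
    shiftDefect (B ∪ B') c ≤ shiftDefect B c + shiftDefect B' c := by
  refine (measureReal_mono ?_).trans (measureReal_union_le _ _)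
  intro x
  simp only [Set.mem_symmDiff, Set.mem_preimage, Set.mem_union]
  tauto

lemma measurableSet_symmDiff_shift {B : Set Torus} (hB : MeasurableSet B) (c : Torus) :
    MeasurableSet (symmDiff ((· + c) ⁻¹' B) B) :=
  ((measurable_add_const c) hB).symmDiff hB

/-- The map is a measure-preserving homomorphism, so pulling back a set amounts to pushing the shift
forward. Stable shifts thereby shrink geometrically, which makes the defect of a whole future
summable. -/
lemma shiftDefect_preimage_iterate {B : Set Torus} (hB : MeasurableSet B) (c : Torus) (i : ℕ) :
    shiftDefect (catMap^[i] ⁻¹' B) c = shiftDefect B (catMap^[i] c) := by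
  unfold shiftDefect
  rw [← (measurePreserving_catMap.iterate i).measureReal_preimage
    (measurableSet_symmDiff_shift hB _).nullMeasurableSet]
  congr 1
  ext x
  simp only [Set.mem_symmDiff, Set.mem_preimage, catMap_iterate_add]

lemma shiftDefect_biInter_le {B : Set Torus} (hB : MeasurableSet B) (c : Torus) (s : Finset ℕ) :
    shiftDefect (⋂ i ∈ s, catMap^[i] ⁻¹' Bᶜ) c ≤ ∑ i ∈ s, shiftDefect B (catMap^[i] c) := by
  induction s using Finset.induction_on with
  | empty => simp [shiftDefect]
  | insert a s ha ih =>
    rw [Finset.set_biInter_insert, Finset.sum_insert ha]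
    refine (shiftDefect_inter_le _ _ _).trans (add_le_add ?_ ih)
    rw [shiftDefect_preimage_iterate hB.compl, shiftDefect_compl]

lemma sum_inv_lam_pow_le (s : Finset ℕ) : ∑ i ∈ s, (lam ^ i)⁻¹ ≤ 2 := by
  have h2 := two_lt_lam
  have h0 : 0 ≤ lam⁻¹ := (inv_pos.2 lam_pos).le
  have h1 : lam⁻¹ ≤ 2⁻¹ := inv_anti₀ (by norm_num) h2.le
  have hs : HasSum (fun i : ℕ => (lam ^ i)⁻¹) (1 - lam⁻¹)⁻¹ := by
    simp_rw [← inv_pow]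
    exact hasSum_geometric_of_lt_one h0 (by linarith)
  refine (sum_le_hasSum s (fun i _ => by have := lam_pos; positivity) hs).trans ?_
  rw [inv_le_comm₀ (by linarith) (by norm_num)]
  linarith

lemma abs_measureReal_inter_sub_le {B B' : Set Torus} (hB : MeasurableSet B)
    (hB' : MeasurableSet B') {V : Set Torus} (hV : MeasurableSet V) :
    |(volume : Measure Torus).real (B ∩ V) - (volume : Measure Torus).real (B' ∩ V)| ≤
      (volume : Measure Torus).real (symmDiff B B') := by
  refine (abs_measureReal_sub_le_measureReal_symmDiff (hB.inter hV).nullMeasurableSet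
    (hB'.inter hV).nullMeasurableSet).trans (measureReal_mono ?_)
  intro x
  simp only [Set.mem_symmDiff, Set.mem_inter_iff]
  tauto

lemma measurableSet_biInter_iterate {B : Set Torus} (hB : MeasurableSet B) (s : Finset ℕ) :
    MeasurableSet (⋂ i ∈ s, catMap^[i] ⁻¹' B) :=
  s.measurableSet_biInter fun i _ => (measurePreserving_catMap.iterate i).measurable hB

/-- Fubini: for fixed `x`, the point `x + φ y` is uniformly distributed. Averaging over translates
thus produces exact independence. -/
lemma integral_measureReal_shift {A V : Set Torus} (hA : MeasurableSet A) (hV : MeasurableSet V)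
    {φ : Torus → Torus} (hφ : MeasurePreserving φ (volume : Measure Torus) volume) :
    Integrable (fun y => (volume : Measure Torus).real ((· + φ y) ⁻¹' A ∩ V)) volume ∧
    ∫ y, (volume : Measure Torus).real ((· + φ y) ⁻¹' A ∩ V) =
      (volume : Measure Torus).real A * (volume : Measure Torus).real V := by
  set Z : Set (Torus × Torus) := {z | z.2 + φ z.1 ∈ A ∧ z.2 ∈ V} with hZ
  have hZm : MeasurableSet Z :=
    ((measurable_snd.add (hφ.measurable.comp measurable_fst)) hA).inter (measurable_snd hV)
  have h1 : (fun y => volume ((· + φ y) ⁻¹' A ∩ V)) = fun y => volume (Prod.mk y ⁻¹' Z) := rfl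
  have hm : Measurable (fun y => volume ((· + φ y) ⁻¹' A ∩ V)) := by
    rw [h1]; exact measurable_measure_prodMk_left hZm
  refine ⟨?_, ?_⟩
  · refine Integrable.of_bound (C := 1) hm.ennreal_toReal.aestronglyMeasurable
      (.of_forall fun y => ?_)
    rw [Real.norm_of_nonneg measureReal_nonneg]
    exact measureReal_le_one
  · simp only [Measure.real]
    rw [integral_toReal hm.aemeasurable (.of_forall fun y => measure_lt_top _ _), h1,
      ← Measure.prod_apply hZm, Measure.prod_apply_symm hZm, ← ENNReal.toReal_mul]
    congr 1
    have h2 (x : Torus) : volume ((fun y => (y, x)) ⁻¹' Z) = V.indicator (fun _ => volume A) x := by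
      by_cases hx : x ∈ V
      · rw [Set.indicator_of_mem hx, ← measure_preimage_add volume x A,
          ← hφ.measure_preimage ((measurable_const_add x) hA).nullMeasurableSet]
        congr 1
        ext y; simp [hZ, hx]
      · rw [Set.indicator_of_notMem hx]
        have : (fun y => (y, x)) ⁻¹' Z = ∅ := by ext y; simp [hZ, hx]
        rw [this, measure_empty]
    simp_rw [h2]
    rw [lintegral_indicator_const hV]

/-- Exponential decay of correlations of a set of finite perimeter with any event built from
its future. -/
theorem abs_measureReal_inter_preimage_sub_le {A : Set Torus} (hA : MeasurableSet A) {C : ℝ}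
    (hu : ∀ h, shiftDefect A (axes (h, 0)) ≤ C * |h|)
    (hs : ∀ h, shiftDefect A (axes (0, h)) ≤ C * |h|) (s : Finset ℕ) (t : ℕ) :
    |(volume : Measure Torus).real (A ∩ catMap^[t] ⁻¹' ⋂ i ∈ s, catMap^[i] ⁻¹' Aᶜ)
      - (volume : Measure Torus).real A *
        (volume : Measure Torus).real (⋂ i ∈ s, catMap^[i] ⁻¹' Aᶜ)| ≤
      6 * C * (lam ^ (t / 2))⁻¹ := by
  set W := ⋂ i ∈ s, catMap^[i] ⁻¹' Aᶜ with hW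
  have hWm : MeasurableSet W := measurableSet_biInter_iterate hA.compl s
  set V := catMap^[t] ⁻¹' W with hV
  have hVm : MeasurableSet V := (measurePreserving_catMap.iterate t).measurable hWm
  have hVW : (volume : Measure Torus).real W = (volume : Measure Torus).real V :=
    ((measurePreserving_catMap.iterate t).measureReal_preimage hWm.nullMeasurableSet).symm
  have hC : 0 ≤ C := by simpa using measureReal_nonneg.trans (hu 1)
  have hl := lam_pos
  -- Half of the gap is spent contracting the unstable part of the translation, leaving at least as
  -- much to contract the expanded stable part.
  set m := t / 2 with hm
  -- Every translate in the average is close to the untranslated intersection. A bounded lift of `y`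
  -- splits its image under `catInv^[m]` into a short unstable part `a` and a long stable part `b`.
  have key (y : Torus) : ‖(volume : Measure Torus).real (A ∩ V) -
      (volume : Measure Torus).real ((· + catInv^[m] y) ⁻¹' A ∩ V)‖ ≤ 6 * C * (lam ^ m)⁻¹ := by
    obtain ⟨w, rfl, hw1, hw2⟩ := exists_axes_eq y
    rw [catInv_iterate_axes]
    set a := axes ((lam ^ m)⁻¹ * w.1, 0) with ha
    set b := axes (0, lam ^ m * w.2) with hb
    have hab : axes ((lam ^ m)⁻¹ * w.1, lam ^ m * w.2) = b + a := by
      rw [ha, hb, ← map_add]; simp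
    rw [hab]
    have hAb : MeasurableSet ((· + b) ⁻¹' A) := (measurable_add_const b) hA
    have hAba : MeasurableSet ((· + (b + a)) ⁻¹' A) := (measurable_add_const (b + a)) hA
    have step1 : |(volume : Measure Torus).real ((· + b) ⁻¹' A ∩ V) -
        (volume : Measure Torus).real ((· + (b + a)) ⁻¹' A ∩ V)| ≤ 2 * C * (lam ^ m)⁻¹ := by
      rw [abs_sub_comm]
      refine (abs_measureReal_inter_sub_le hAba hAb hVm).trans ?_
      have : symmDiff ((· + (b + a)) ⁻¹' A) ((· + b) ⁻¹' A)
          = (· + b) ⁻¹' symmDiff ((· + a) ⁻¹' A) A := by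
        ext x; simp only [Set.mem_symmDiff, Set.mem_preimage, add_assoc]
      rw [this, measureReal_def, measure_preimage_add_right]
      refine (hu _).trans ?_
      rw [abs_mul, abs_of_pos (inv_pos.2 (pow_pos hl m))]
      have : 0 < (lam ^ m)⁻¹ := by positivity
      nlinarith [mul_le_mul_of_nonneg_left hw1 (mul_nonneg hC this.le)]
    have step2 : |(volume : Measure Torus).real (A ∩ V) -
        (volume : Measure Torus).real ((· + b) ⁻¹' A ∩ V)| ≤ 4 * C * (lam ^ m)⁻¹ := by
      -- The stable part is too long for `A` to absorb; translation invariance moves it onto `V`,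
      -- whose defect involves only forward images of `b`.
      have h1 : (volume : Measure Torus).real ((· + b) ⁻¹' A ∩ V)
          = (volume : Measure Torus).real ((· + (-b)) ⁻¹' V ∩ A) := by
        rw [measureReal_def, measureReal_def, ← measure_preimage_add_right volume b (_ ∩ A)]
        congr 2
        ext x; simp [and_comm]
      rw [h1, Set.inter_comm A V, abs_sub_comm]
      refine (abs_measureReal_inter_sub_le ((measurable_add_const (-b)) hVm) hVm hA).trans ?_
      change shiftDefect V (-b) ≤ _
      rw [hV, shiftDefect_preimage_iterate hWm]
      refine (shiftDefect_biInter_le hA _ s).trans ?_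
      have hterm (i : ℕ) : shiftDefect A (catMap^[i] (catMap^[t] (-b))) ≤
          2 * C * (lam ^ m)⁻¹ * (lam ^ i)⁻¹ := by
        rw [hb, ← map_neg, catMap_iterate_axes, catMap_iterate_axes]
        simp only [Prod.fst_neg, Prod.snd_neg, neg_zero, mul_zero]
        refine (hs _).trans ?_
        -- This is `2 * m ≤ t`.
        have hle : (lam ^ t)⁻¹ * lam ^ m ≤ (lam ^ m)⁻¹ := by
          rw [inv_mul_le_iff₀ (by positivity), ← div_eq_mul_inv, le_div_iff₀ (by positivity),
            ← pow_add]
          exact pow_le_pow_right₀ (by linarith [two_lt_lam]) (by omega)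
        rw [abs_mul, abs_mul, abs_neg, abs_mul, abs_of_pos (inv_pos.2 (pow_pos hl i)),
          abs_of_pos (inv_pos.2 (pow_pos hl t)), abs_of_pos (pow_pos hl m)]
        calc C * ((lam ^ i)⁻¹ * ((lam ^ t)⁻¹ * (lam ^ m * |w.2|)))
            = C * (lam ^ i)⁻¹ * (((lam ^ t)⁻¹ * lam ^ m) * |w.2|) := by ring
          _ ≤ C * (lam ^ i)⁻¹ * ((lam ^ m)⁻¹ * 2) := by gcongr
          _ = _ := by ring
      refine (Finset.sum_le_sum fun i _ => hterm i).trans ?_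
      rw [← Finset.mul_sum]
      have : 0 ≤ 2 * C * (lam ^ m)⁻¹ := by positivity
      nlinarith [mul_le_mul_of_nonneg_left (sum_inv_lam_pow_le s) this]
    rw [Real.norm_eq_abs]
    have := abs_sub_le ((volume : Measure Torus).real (A ∩ V))
      ((volume : Measure Torus).real ((· + b) ⁻¹' A ∩ V))
      ((volume : Measure Torus).real ((· + (b + a)) ⁻¹' A ∩ V))
    linarith
  obtain ⟨hint, hval⟩ := integral_measureReal_shift hA hVm (measurePreserving_catInv.iterate m)
  have h3 := norm_integral_le_of_norm_le_const (μ := (volume : Measure Torus)) (.of_forall key)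
  rw [integral_sub (integrable_const _) hint, hval, integral_const] at h3
  rw [hVW]
  simpa using h3

end

noncomputable section

/-! ### Neighbourhoods of unstable segments -/

lemma isOpenMap_stdCover : IsOpenMap stdCover :=
  IsOpenMap.prodMap QuotientAddGroup.isOpenMap_coe QuotientAddGroup.isOpenMap_coe

lemma isOpenMap_axes : IsOpenMap axes := by
  have hdet : LinearMap.det rot ≠ 0 := by rw [det_rot]; exact one_ne_zero
  have h : (axes : ℝ × ℝ → Torus) = stdCover ∘ rot := funext axes_eq_stdCover
  rw [h]
  exact isOpenMap_stdCover.comp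
    (rot.equivOfDetNeZero hdet).toContinuousLinearEquiv.toHomeomorph.isOpenMap

/-- The open `r`-neighbourhood of the segment `(a, b) × {0}` of the plane. -/
def stadium (a b r : ℝ) : Set (ℝ × ℝ) :=
  {w | ∃ s ∈ Set.Ioo a b, (w.1 - s) ^ 2 + w.2 ^ 2 < r ^ 2}

lemma isOpen_stadium (a b r : ℝ) : IsOpen (stadium a b r) := by
  have : stadium a b r = ⋃ s ∈ Set.Ioo a b, {w : ℝ × ℝ | (w.1 - s) ^ 2 + w.2 ^ 2 < r ^ 2} := by
    ext w; simp [stadium]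
  rw [this]
  exact isOpen_biUnion fun s _ => isOpen_lt (by fun_prop) (by fun_prop)

lemma convex_stadium (a b r : ℝ) : Convex ℝ (stadium a b r) := by
  rintro w ⟨s, hs, hw⟩ w' ⟨s', hs', hw'⟩ x y hx hy hxy
  refine ⟨x * s + y * s', (convex_Ioo a b) hs hs' hx hy hxy, ?_⟩
  simp only [Prod.fst_add, Prod.snd_add, Prod.smul_fst, Prod.smul_snd, smul_eq_mul]
  have hy' : y = 1 - x := by linarith
  have h1 : x * ((w.1 - s) ^ 2 + w.2 ^ 2) + y * ((w'.1 - s') ^ 2 + w'.2 ^ 2) < r ^ 2 := by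
    rcases hx.eq_or_lt with h | h
    · rw [← h, zero_mul, zero_add]; rw [← h] at hy'; rw [hy']; linarith
    · have := mul_lt_mul_of_pos_left hw h
      have := mul_le_mul_of_nonneg_left hw'.le hy
      have : x * r ^ 2 + y * r ^ 2 = r ^ 2 := by rw [hy']; ring
      linarith
  -- This is exactly the convexity defect of the squared norm.
  have h2 : 0 ≤ x * y * (((w.1 - s) - (w'.1 - s')) ^ 2 + (w.2 - w'.2) ^ 2) := by positivity
  refine lt_of_le_of_lt ?_ h1
  rw [hy'] at h2 ⊢
  linarith

lemma abs_lt_of_mem_stadium {a b r : ℝ} (hr : 0 ≤ r) {w : ℝ × ℝ} (h : w ∈ stadium a b r) :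
    w.1 ∈ Set.Ioo (a - r) (b + r) ∧ |w.2| < r := by
  obtain ⟨s, hs, hw⟩ := h
  have h1 := abs_lt_of_sq_lt_sq (by nlinarith [sq_nonneg w.2] : (w.1 - s) ^ 2 < r ^ 2) hr
  have h2 := abs_lt_of_sq_lt_sq (by nlinarith [sq_nonneg (w.1 - s)] : w.2 ^ 2 < r ^ 2) hr
  rw [abs_lt] at h1
  exact ⟨⟨by linarith [hs.1], by linarith [hs.2]⟩, h2⟩

lemma mem_stadium_of_mem_Ioo {a b r : ℝ} {w : ℝ × ℝ} (h : w.1 ∈ Set.Ioo a b) (h2 : |w.2| < r) :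
    w ∈ stadium a b r := by
  refine ⟨w.1, h, ?_⟩
  rw [sub_self, ← sq_abs w.2]
  nlinarith [abs_nonneg w.2]

lemma stadium_mono (a b : ℝ) {r r' : ℝ} (hr : 0 ≤ r) (h : r ≤ r') :
    stadium a b r ⊆ stadium a b r' := by
  rintro w ⟨s, hs, hw⟩
  exact ⟨s, hs, hw.trans_le (by gcongr)⟩

lemma exists_coe_eq_abs_eq (x : UnitAddCircle) : ∃ a : ℝ, (a : UnitAddCircle) = x ∧ |a| = ‖x‖ := by
  obtain ⟨a, rfl⟩ := QuotientAddGroup.mk_surjective x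
  refine ⟨a - round a, ?_, (UnitAddCircle.norm_eq).symm⟩
  have : ((round a : ℝ) : UnitAddCircle) = 0 :=
    (AddCircle.coe_eq_zero_iff 1).2 ⟨round a, by simp⟩
  rw [AddCircle.coe_sub, this, sub_zero]

lemma norm_coe_le_abs (a : ℝ) : ‖(a : UnitAddCircle)‖ ≤ |a| := by
  rw [UnitAddCircle.norm_eq]
  simpa using round_le a 0

lemma rot_norm_sq (x y : ℝ) : (x * eCos - y * eSin) ^ 2 + (x * eSin + y * eCos) ^ 2
    = x ^ 2 + y ^ 2 := by
  linear_combination (x ^ 2 + y ^ 2) * eCos_sq_add_eSin_sq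

lemma flatDist_axes_lt_iff {p : Torus} {z : ℝ × ℝ} {r : ℝ} (hr : 0 ≤ r) :
    flatDist p (axes z) < r ↔
      ∃ w, axes w = p ∧ (w.1 - z.1) ^ 2 + (w.2 - z.2) ^ 2 < r ^ 2 := by
  rcases hr.eq_or_lt with rfl | hr
  · constructor
    · intro h; exact absurd h (not_lt.2 (Real.sqrt_nonneg _))
    · rintro ⟨w, -, h⟩; nlinarith [sq_nonneg (w.1 - z.1), sq_nonneg (w.2 - z.2)]
  rw [flatDist, Real.sqrt_lt' hr, dist_eq_norm, dist_eq_norm]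
  constructor
  · intro h
    obtain ⟨a, ha, ha'⟩ := exists_coe_eq_abs_eq (p.1 - (axes z).1)
    obtain ⟨b, hb, hb'⟩ := exists_coe_eq_abs_eq (p.2 - (axes z).2)
    rw [← ha', ← hb', sq_abs, sq_abs] at h
    have h1 := eCos_sq_add_eSin_sq
    refine ⟨z + (a * eCos + b * eSin, b * eCos - a * eSin), ?_, ?_⟩
    · rw [map_add]
      have : axes (a * eCos + b * eSin, b * eCos - a * eSin) = p - axes z := by
        rw [axes_apply]
        ext
        · rw [Prod.fst_sub, ← ha]; dsimp only; congr 1; linear_combination a * h1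
        · rw [Prod.snd_sub, ← hb]; dsimp only; congr 1; linear_combination b * h1
      rw [this]; abel
    · simp only [Prod.fst_add, Prod.snd_add, add_sub_cancel_left]
      refine lt_of_eq_of_lt ?_ h
      linear_combination (a ^ 2 + b ^ 2) * h1
  · rintro ⟨w, rfl, h⟩
    refine lt_of_le_of_lt ?_ h
    have h1 : (axes w).1 - (axes z).1 =
        (((w.1 - z.1) * eCos - (w.2 - z.2) * eSin : ℝ) : UnitAddCircle) := by
      rw [axes_apply, axes_apply, ← AddCircle.coe_sub]; congr 1; ring
    have h2 : (axes w).2 - (axes z).2 =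
        (((w.1 - z.1) * eSin + (w.2 - z.2) * eCos : ℝ) : UnitAddCircle) := by
      rw [axes_apply, axes_apply, ← AddCircle.coe_sub]; congr 1; ring
    rw [h1, h2, ← rot_norm_sq (w.1 - z.1), ← sq_abs ((w.1 - z.1) * eCos - (w.2 - z.2) * eSin),
      ← sq_abs ((w.1 - z.1) * eSin + (w.2 - z.2) * eCos)]
    gcongr <;> exact norm_coe_le_abs _

lemma flatDist_nonneg (p p' : Torus) : 0 ≤ flatDist p p' := Real.sqrt_nonneg _

lemma distTo_lt_iff {p : Torus} {Z : Set Torus} (hZ : Z.Nonempty) {r : ℝ} :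
    distTo p Z < r ↔ ∃ z ∈ Z, flatDist p z < r := by
  rw [distTo, csInf_lt_iff ⟨0, by rintro _ ⟨z, -, rfl⟩; exact flatDist_nonneg _ _⟩ (hZ.image _)]
  simp

lemma distTo_nonneg (p : Torus) (Z : Set Torus) : 0 ≤ distTo p Z :=
  Real.sInf_nonneg (by rintro _ ⟨z, -, rfl⟩; exact flatDist_nonneg _ _)

/-- The bound lets a level lying below the whole range of an observable be encoded by a radius
larger than 1. -/
lemma distTo_le_one (p : Torus) {Z : Set Torus} (hZ : Z.Nonempty) : distTo p Z ≤ 1 := by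
  obtain ⟨z, hz⟩ := hZ
  refine (csInf_le ⟨0, by rintro _ ⟨z, -, rfl⟩; exact flatDist_nonneg _ _⟩
    (Set.mem_image_of_mem _ hz)).trans ?_
  rw [flatDist, Real.sqrt_le_one]
  have hone (x y : UnitAddCircle) : dist x y ≤ 1 / 2 := by
    rw [dist_eq_norm]
    simpa using AddCircle.norm_le_half_period (1 : ℝ) (x := x - y) one_ne_zero
  nlinarith [hone p.1 z.1, hone p.2 z.2, dist_nonneg (x := p.1) (y := z.1),
    dist_nonneg (x := p.2) (y := z.2)]

lemma continuous_flatDist (z : Torus) : Continuous (fun p => flatDist p z) := by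
  unfold flatDist; fun_prop

lemma measurable_distTo {Z : Set Torus} (hZ : Z.Nonempty) : Measurable (fun p => distTo p Z) := by
  refine measurable_of_Iio fun r => ?_
  have : (fun p => distTo p Z) ⁻¹' Set.Iio r = ⋃ z ∈ Z, {p | flatDist p z < r} := by
    ext p; simp [distTo_lt_iff hZ]
  rw [this]
  exact (isOpen_biUnion fun z _ => isOpen_lt (continuous_flatDist z) continuous_const).measurableSet

/-- A strict bound on an infimum is attained by some member, and a flat distance below `r` is
witnessed by some lift. -/
lemma setOf_distTo_lt {a b r : ℝ} (hab : a < b) (hr : 0 ≤ r) :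
    {p | distTo p (unstablePoint '' Set.Ioo a b) < r} = axes '' stadium a b r := by
  ext p
  rw [Set.mem_ofPred_eq, distTo_lt_iff ((Set.nonempty_Ioo.2 hab).image _)]
  simp only [Set.exists_mem_image, unstablePoint_eq, flatDist_axes_lt_iff hr, sub_zero]
  constructor
  · rintro ⟨s, hs, w, hw, h⟩
    exact ⟨w, ⟨s, hs, h⟩, hw⟩
  · rintro ⟨w, ⟨s, hs, h⟩, hw⟩
    exact ⟨s, hs, w, hw, h⟩

/-! ### Perimeter of convex sets -/

/-- The difference has diameter at most `|h|`: given two points further apart, order convexity would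
put one of them in `J`. -/
lemma volume_shift_diff_le {J : Set ℝ} (hJ : J.OrdConnected) (h : ℝ) :
    volume ({x | x + h ∈ J} \ J) ≤ ENNReal.ofReal |h| := by
  refine (Real.volume_le_diam _).trans (Metric.ediam_le fun x hx y hy => ?_)
  rw [edist_dist]
  refine ENNReal.ofReal_le_ofReal ?_
  wlog hxy : x ≤ y generalizing x y
  · rw [dist_comm]; exact this y hy x hx (not_le.1 hxy).le
  rw [dist_comm, Real.dist_eq, abs_of_nonneg (sub_nonneg.2 hxy)]
  by_contra hlt
  rw [not_le] at hlt
  rcases le_total 0 h with h0 | h0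
  · rw [abs_of_nonneg h0] at hlt
    exact hy.2 (hJ.out hx.1 hy.1 ⟨by linarith, by linarith⟩)
  · rw [abs_of_nonpos h0] at hlt
    exact hx.2 (hJ.out hx.1 hy.1 ⟨by linarith, by linarith⟩)

/-- Slices of a convex set are intervals, so the one-dimensional bound integrates over the
transverse width `2 * M`. -/
lemma volume_shift_fst_diff_le {S : Set (ℝ × ℝ)} (hS : Convex ℝ S) (hm : MeasurableSet S) {M : ℝ}
    (hM : ∀ w ∈ S, |w.2| ≤ M) (h : ℝ) :
    volume ({w | w + (h, 0) ∈ S} \ S) ≤ ENNReal.ofReal |h| * ENNReal.ofReal (2 * M) := by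
  have hm' : MeasurableSet ({w | w + (h, 0) ∈ S} \ S) := ((measurable_add_const (h, 0)) hm).diff hm
  rw [Measure.volume_eq_prod, Measure.prod_apply_symm hm']
  have hb (y : ℝ) : volume ((fun x => (x, y)) ⁻¹' ({w | w + (h, 0) ∈ S} \ S)) ≤
      (Set.Icc (-M) M).indicator (fun _ => ENNReal.ofReal |h|) y := by
    by_cases hy : y ∈ Set.Icc (-M) M
    · rw [Set.indicator_of_mem hy]
      have hJ : ((fun x : ℝ => (x, y)) ⁻¹' S).OrdConnected := by
        have := hS.affine_preimage
          ((LinearMap.inl ℝ ℝ ℝ).toAffineMap + AffineMap.const ℝ ℝ ((0 : ℝ), y))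
        convert! this.ordConnected using 1
        ext x; simp
      convert volume_shift_diff_le hJ h using 2
      ext x; simp
    · rw [Set.indicator_of_notMem hy]
      have : (fun x => (x, y)) ⁻¹' ({w | w + (h, 0) ∈ S} \ S) = ∅ := by
        ext x
        simp only [Set.mem_preimage, Set.mem_sdiff, Set.mem_ofPred_eq, Set.mem_empty_iff_false,
          iff_false, not_and]
        intro hx
        exact absurd (abs_le.1 (by simpa using hM _ hx)) hy
      rw [this, measure_empty]
  refine (lintegral_mono hb).trans ?_
  rw [lintegral_indicator_const measurableSet_Icc, Real.volume_Icc]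
  gcongr
  linarith

lemma volume_shift_snd_diff_le {S : Set (ℝ × ℝ)} (hS : Convex ℝ S) (hm : MeasurableSet S) {M : ℝ}
    (hM : ∀ w ∈ S, |w.1| ≤ M) (h : ℝ) :
    volume ({w | w + (0, h) ∈ S} \ S) ≤ ENNReal.ofReal |h| * ENNReal.ofReal (2 * M) := by
  have hm' : MeasurableSet ({w | w + (0, h) ∈ S} \ S) := ((measurable_add_const (0, h)) hm).diff hm
  rw [Measure.volume_eq_prod, Measure.prod_apply hm']
  have hb (x : ℝ) : volume (Prod.mk x ⁻¹' ({w | w + (0, h) ∈ S} \ S)) ≤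
      (Set.Icc (-M) M).indicator (fun _ => ENNReal.ofReal |h|) x := by
    by_cases hx : x ∈ Set.Icc (-M) M
    · rw [Set.indicator_of_mem hx]
      have hJ : (Prod.mk x ⁻¹' S).OrdConnected := by
        have := hS.affine_preimage
          ((LinearMap.inr ℝ ℝ ℝ).toAffineMap + AffineMap.const ℝ ℝ (x, (0 : ℝ)))
        convert! this.ordConnected using 1
        ext y; simp
      convert volume_shift_diff_le hJ h using 2
      ext y; simp
    · rw [Set.indicator_of_notMem hx]
      have : Prod.mk x ⁻¹' ({w | w + (0, h) ∈ S} \ S) = ∅ := by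
        ext y
        simp only [Set.mem_preimage, Set.mem_sdiff, Set.mem_ofPred_eq, Set.mem_empty_iff_false,
          iff_false, not_and]
        intro hy
        exact absurd (abs_le.1 (by simpa using hM _ hy)) hx
      rw [this, measure_empty]
  refine (lintegral_mono hb).trans ?_
  rw [lintegral_indicator_const measurableSet_Icc, Real.volume_Icc]
  gcongr
  linarith

/-- Projection can only lose boundary: a point that the shift sends into the image has a lift sent
into `S`, and that lift lies outside `S`. No injectivity is required. -/
lemma volume_image_axes_shift_diff_le {S : Set (ℝ × ℝ)} (hS : IsOpen S) (v : ℝ × ℝ) :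
    volume ((· + axes v) ⁻¹' (axes '' S) \ (axes '' S)) ≤ volume ({w | w + v ∈ S} \ S) := by
  have hU := (isOpenMap_axes S hS).measurableSet
  refine volume_le_of_subset_image_axes (((measurable_add_const _) hU).diff hU)
    (((measurable_add_const v) hS.measurableSet).diff hS.measurableSet) ?_
  rintro x ⟨⟨w, hw, hwx⟩, hx⟩
  have hx' : axes (w - v) = x := by rw [map_sub, hwx]; simp
  refine ⟨w - v, ⟨by simpa using hw, fun h => hx ⟨_, h, hx'⟩⟩, hx'⟩

lemma shiftDefect_image_axes_le {S : Set (ℝ × ℝ)} (hS : IsOpen S) (v : ℝ × ℝ) {K : ℝ} (hK : 0 ≤ K)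
    (h1 : volume ({w | w + v ∈ S} \ S) ≤ ENNReal.ofReal K)
    (h2 : volume ({w | w + (-v) ∈ S} \ S) ≤ ENNReal.ofReal K) :
    shiftDefect (axes '' S) (axes v) ≤ 2 * K := by
  have e1 := ENNReal.toReal_le_of_le_ofReal hK ((volume_image_axes_shift_diff_le hS v).trans h1)
  have e2 := ENNReal.toReal_le_of_le_ofReal hK ((volume_image_axes_shift_diff_le hS (-v)).trans h2)
  have h3 : volume ((· + axes (-v)) ⁻¹' (axes '' S) \ (axes '' S))
      = volume ((axes '' S) \ (· + axes v) ⁻¹' (axes '' S)) := by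
    rw [← measure_preimage_add_right volume (axes v)]
    congr 1
    ext x
    simp only [map_neg, Set.mem_preimage, Set.mem_sdiff, add_neg_cancel_right]
  rw [h3] at e2
  rw [shiftDefect, Set.symmDiff_def]
  refine (measureReal_union_le _ _).trans ?_
  rw [measureReal_def, measureReal_def]
  linarith

lemma shiftDefect_convex_le {S : Set (ℝ × ℝ)} (hS : IsOpen S) (hc : Convex ℝ S) {M : ℝ}
    (hM0 : 0 ≤ M) (hM : ∀ w ∈ S, |w.1| ≤ M ∧ |w.2| ≤ M) (h : ℝ) :
    shiftDefect (axes '' S) (axes (h, 0)) ≤ 4 * M * |h| ∧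
    shiftDefect (axes '' S) (axes (0, h)) ≤ 4 * M * |h| := by
  have hK : 0 ≤ |h| * (2 * M) := by positivity
  have e (h' : ℝ) := volume_shift_fst_diff_le hc hS.measurableSet (fun w hw => (hM w hw).2) h'
  have e' (h' : ℝ) := volume_shift_snd_diff_le hc hS.measurableSet (fun w hw => (hM w hw).1) h'
  simp only [← ENNReal.ofReal_mul (abs_nonneg _)] at e e'
  constructor
  · refine (shiftDefect_image_axes_le hS (h, 0) hK (e h) ?_).trans (by linarith)
    simpa using e (-h)
  · refine (shiftDefect_image_axes_le hS (0, h) hK (e' h) ?_).trans (by linarith)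
    simpa using e' (-h)

end

noncomputable section

/-! ### The two neighbourhoods and their returns -/

/-- The union of the neighbourhoods of the two segments, in the plane. -/
def planeNhd (ε r₁ r₂ : ℝ) : Set (ℝ × ℝ) :=
  stadium (-ε) ε r₁ ∪ stadium (lam * ε) (lam ^ 2 * ε) r₂

/-- The union of the neighbourhoods of the two segments, in the torus. -/
def torusNhd (ε r₁ r₂ : ℝ) : Set Torus := axes '' planeNhd ε r₁ r₂

/-- A bound for the unstable coordinates in `planeNhd`. -/
def reach (ε : ℝ) : ℝ := lam ^ 2 * ε + 1

/-- The linear lift of the `i`-th iterate of the cat map. -/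
def linFlow (i : ℕ) (w : ℝ × ℝ) : ℝ × ℝ := (lam ^ i * w.1, (lam ^ i)⁻¹ * w.2)

/-- The points of `U` whose next `q` iterates avoid `U`. -/
def clusterSet (U : Set Torus) (q : ℕ) : Set Torus :=
  U ∩ ⋂ i ∈ Finset.Icc 1 q, catMap^[i] ⁻¹' Uᶜ

/-- The points of `S` whose next `q` images under the linear flow avoid `S`. -/
def planeCluster (S : Set (ℝ × ℝ)) (q : ℕ) : Set (ℝ × ℝ) :=
  {w | w ∈ S ∧ ∀ i ∈ Finset.Icc 1 q, linFlow i w ∉ S}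

lemma catMap_iterate_axes_eq (i : ℕ) (w : ℝ × ℝ) : catMap^[i] (axes w) = axes (linFlow i w) :=
  catMap_iterate_axes i w

lemma one_le_lam_pow (i : ℕ) : 1 ≤ lam ^ i := one_le_pow₀ (by linarith [two_lt_lam])

lemma mem_clusterSet {U : Set Torus} {q : ℕ} {x : Torus} :
    x ∈ clusterSet U q ↔ x ∈ U ∧ ∀ i ∈ Finset.Icc 1 q, catMap^[i] x ∉ U := by
  simp [clusterSet]

lemma measurableSet_clusterSet {U : Set Torus} (hU : MeasurableSet U) (q : ℕ) :
    MeasurableSet (clusterSet U q) := hU.inter (measurableSet_biInter_iterate hU.compl _)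

lemma isOpen_planeNhd (ε r₁ r₂ : ℝ) : IsOpen (planeNhd ε r₁ r₂) :=
  (isOpen_stadium _ _ _).union (isOpen_stadium _ _ _)

lemma measurableSet_torusNhd (ε r₁ r₂ : ℝ) : MeasurableSet (torusNhd ε r₁ r₂) :=
  (isOpenMap_axes _ (isOpen_planeNhd ε r₁ r₂)).measurableSet

variable {ε r₁ r₂ r : ℝ}

lemma reach_pos (hε : 0 < ε) : 0 < reach ε := by unfold reach; positivity

lemma abs_le_of_mem_planeNhd (hε : 0 < ε) (h₁ : 0 ≤ r₁) (h₂ : 0 ≤ r₂) (h₁r : r₁ ≤ r) (h₂r : r₂ ≤ r)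
    {w : ℝ × ℝ} (hw : w ∈ planeNhd ε r₁ r₂) : |w.1| ≤ lam ^ 2 * ε + r ∧ |w.2| < r := by
  have hl := two_lt_lam
  have hl2 : ε ≤ lam ^ 2 * ε := le_mul_of_one_le_left hε.le (one_le_lam_pow 2)
  have hl1 : 0 < lam * ε := mul_pos lam_pos hε
  rcases hw with hw | hw
  · obtain ⟨⟨ha, hb⟩, hc⟩ := abs_lt_of_mem_stadium h₁ hw
    exact ⟨abs_le.2 ⟨by linarith, by linarith⟩, by linarith⟩
  · obtain ⟨⟨ha, hb⟩, hc⟩ := abs_lt_of_mem_stadium h₂ hw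
    exact ⟨abs_le.2 ⟨by linarith, by linarith⟩, by linarith⟩

lemma shiftDefect_torusNhd_le (hε : 0 < ε) (h₁ : 0 ≤ r₁) (h₂ : 0 ≤ r₂) (h₁r : r₁ ≤ 1) (h₂r : r₂ ≤ 1)
    (h : ℝ) : shiftDefect (torusNhd ε r₁ r₂) (axes (h, 0)) ≤ 8 * reach ε * |h| ∧
      shiftDefect (torusNhd ε r₁ r₂) (axes (0, h)) ≤ 8 * reach ε * |h| := by
  have hR := (reach_pos hε).le
  have h1R : 1 ≤ reach ε := by unfold reach; linarith [show 0 ≤ lam ^ 2 * ε by positivity]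
  have hb (w) (hw : w ∈ planeNhd ε r₁ r₂) : |w.1| ≤ reach ε ∧ |w.2| ≤ reach ε := by
    obtain ⟨ha, hb⟩ := abs_le_of_mem_planeNhd hε h₁ h₂ h₁r h₂r hw
    exact ⟨ha, hb.le.trans h1R⟩
  have e1 := shiftDefect_convex_le (isOpen_stadium (-ε) ε r₁) (convex_stadium _ _ _) hR
    (fun w hw => hb w (.inl hw)) h
  have e2 := shiftDefect_convex_le (isOpen_stadium (lam * ε) (lam ^ 2 * ε) r₂)
    (convex_stadium _ _ _) hR (fun w hw => hb w (.inr hw)) h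
  rw [torusNhd, planeNhd, Set.image_union]
  exact ⟨(shiftDefect_union_le _ _ _).trans (by linarith [e1.1, e2.1]),
    (shiftDefect_union_le _ _ _).trans (by linarith [e1.2, e2.2])⟩

/-- The Lipschitz constant for translates of `clusterSet (torusNhd ε r₁ r₂) q`. -/
def perimeterBound (ε : ℝ) (q : ℕ) : ℝ := (1 + q * lam ^ q) * (8 * reach ε)

/-- Each of the `q` pullbacks stretches a shift by at most `lam ^ q`. The constant depends on `q`
but not on the radii, so the mixing rate is uniform in `n`. -/
lemma shiftDefect_clusterSet_le (hε : 0 < ε) (h₁ : 0 ≤ r₁) (h₂ : 0 ≤ r₂) (h₁r : r₁ ≤ 1)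
    (h₂r : r₂ ≤ 1) (q : ℕ) (h : ℝ) :
    shiftDefect (clusterSet (torusNhd ε r₁ r₂) q) (axes (h, 0)) ≤ perimeterBound ε q * |h| ∧
    shiftDefect (clusterSet (torusNhd ε r₁ r₂) q) (axes (0, h)) ≤ perimeterBound ε q * |h| := by
  have hd := shiftDefect_torusNhd_le hε h₁ h₂ h₁r h₂r
  have hl := lam_pos
  have hR := reach_pos hε
  have hgen (c : Torus) (h0 : shiftDefect (torusNhd ε r₁ r₂) c ≤ 8 * reach ε * |h|)
      (hi : ∀ i ∈ Finset.Icc 1 q, shiftDefect (torusNhd ε r₁ r₂) (catMap^[i] c) ≤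
        lam ^ q * (8 * reach ε * |h|)) :
      shiftDefect (clusterSet (torusNhd ε r₁ r₂) q) c ≤ perimeterBound ε q * |h| := by
    refine (shiftDefect_inter_le _ _ _).trans ?_
    have := (shiftDefect_biInter_le (measurableSet_torusNhd ε r₁ r₂) c (Finset.Icc 1 q)).trans
      (Finset.sum_le_card_nsmul _ _ _ hi)
    rw [Nat.card_Icc, nsmul_eq_mul, Nat.add_sub_cancel] at this
    unfold perimeterBound
    linarith
  constructor
  · refine hgen _ (hd h).1 fun i hi => ?_
    rw [catMap_iterate_axes_eq, linFlow]
    simp only [mul_zero]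
    refine (hd _).1.trans ?_
    rw [abs_mul, abs_of_pos (pow_pos hl i), mul_left_comm]
    gcongr
    · linarith [two_lt_lam]
    · exact (Finset.mem_Icc.1 hi).2
  · refine hgen _ (hd h).2 fun i hi => ?_
    rw [catMap_iterate_axes_eq, linFlow]
    simp only [mul_zero]
    refine (hd _).2.trans ?_
    rw [abs_mul, abs_of_pos (inv_pos.2 (pow_pos hl i)), mul_left_comm]
    gcongr
    exact (inv_le_one_of_one_le₀ (one_le_lam_pow i)).trans (one_le_lam_pow q)

/-- Points of a thin box that return to the box along a different sheet of the covering. -/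
lemma measureReal_le_of_sheet_change {V : Set Torus} (hV : MeasurableSet V) {E : ℝ} (hE : 0 < E)
    (hr : 0 < r) (j : ℕ)
    (h : ∀ x ∈ V, ∃ w w' : ℝ × ℝ, axes w = x ∧ axes w' = catMap^[j] x ∧ w' ≠ linFlow j w ∧
      |w.1| ≤ E ∧ |w.2| ≤ r ∧ |w'.1| ≤ E ∧ |w'.2| ≤ r) :
    (volume : Measure Torus).real V ≤ 128 * E ^ 2 / latticeGap * r ^ 2 := by
  have hκ := latticeGap_pos
  have hl := pow_pos lam_pos j
  have hl1 := one_le_lam_pow j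
  set X := 2 * lam ^ j * E with hX
  set σ := latticeGap / (4 * r) with hσ
  have hσ0 : 0 < σ := by positivity
  set K : Set (ℝ × ℝ) := {k | axes k = 0 ∧ k ≠ 0 ∧ |k.1| ≤ X ∧ |k.2| ≤ 2 * r} with hK
  -- Lattice vectors in a strip of height `O(r)` are `latticeGap / (4 * r)` apart horizontally.
  -- Their number is thus `O(lam ^ j * r)`, while each accounts for a box of area `O(r / lam ^ j)`:
  -- the powers of `lam` cancel and the bound is uniform in `j`.
  have hsep {k k' : ℝ × ℝ} (hk : k ∈ K) (hk' : k' ∈ K) (hne : k ≠ k') : σ ≤ |k.1 - k'.1| := by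
    have h1 := latticeGap_le_of_ne (hk.1.trans hk'.1.symm) hne
    have h2 : |k.2 - k'.2| ≤ 4 * r :=
      (abs_sub _ _).trans (by linarith [hk.2.2.2, hk'.2.2.2])
    rw [hσ, div_le_iff₀ (by positivity)]
    exact h1.trans (mul_le_mul_of_nonneg_left h2 (abs_nonneg _))
  have hinj : Set.InjOn (fun k : ℝ × ℝ => ⌊k.1 / σ⌋) K := by
    intro k hk k' hk' heq
    by_contra hne
    have h1 := Int.abs_sub_lt_one_of_floor_eq_floor heq
    rw [← sub_div, abs_div, abs_of_pos hσ0, div_lt_one hσ0] at h1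
    exact absurd (hsep hk hk' hne) (not_le.2 h1)
  have hmaps : Set.MapsTo (fun k : ℝ × ℝ => ⌊k.1 / σ⌋) K
      (Finset.Icc ⌊-(X / σ)⌋ ⌊X / σ⌋ : Finset ℤ) := by
    intro k hk
    have h1 := abs_le.1 hk.2.2.1
    rw [Finset.coe_Icc]
    refine ⟨Int.floor_mono ?_, Int.floor_mono ?_⟩
    · rw [← neg_div]; gcongr; exact h1.1
    · gcongr; exact h1.2
  have hfin : K.Finite := Set.Finite.of_injOn hmaps hinj (Finset.finite_toSet _)
  have hcard : (hfin.toFinset.card : ℝ) ≤ 4 * (X / σ) := by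
    have h1 : hfin.toFinset.card ≤ (Finset.Icc ⌊-(X / σ)⌋ ⌊X / σ⌋).card :=
      Finset.card_le_card_of_injOn _ (by simpa using hmaps) (by simpa using hinj)
    rcases hfin.toFinset.eq_empty_or_nonempty with h0 | ⟨k, hk⟩
    · rw [h0, Finset.card_empty, Nat.cast_zero]; positivity
    · rw [hfin.mem_toFinset] at hk
      -- A single vector in `K` already forces `X / σ ≥ 2` by the lattice gap, which absorbs the
      -- rounding in the count.
      have h2 : 2 ≤ X / σ := by
        have h3 := latticeGap_le hk.1 hk.2.1
        have h4 := h3.trans (mul_le_mul_of_nonneg_left hk.2.2.2 (abs_nonneg _))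
        rw [le_div_iff₀ hσ0, hσ, ← mul_div_assoc, div_le_iff₀ (by positivity)]
        nlinarith [hk.2.2.1]
      rw [Int.card_Icc] at h1
      have h5 : (hfin.toFinset.card : ℤ) ≤ ⌊X / σ⌋ + 1 - ⌊-(X / σ)⌋ := by
        have : ⌊-(X / σ)⌋ ≤ ⌊X / σ⌋ := Int.floor_mono (by linarith)
        omega
      have h6 : (hfin.toFinset.card : ℝ) ≤ ⌊X / σ⌋ + 1 - ⌊-(X / σ)⌋ := by exact_mod_cast h5
      linarith [Int.floor_le (X / σ), Int.lt_floor_add_one (-(X / σ))]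
  have hsub : V ⊆ axes '' ⋃ k ∈ hfin.toFinset,
      Set.Icc ((k.1 - E) / lam ^ j) ((k.1 + E) / lam ^ j) ×ˢ Set.Icc (-r) r := by
    intro x hx
    obtain ⟨w, w', hwx, hwx', hne, h1, h2, h3, h4⟩ := h x hx
    refine ⟨w, ?_, hwx⟩
    simp only [Set.mem_iUnion, exists_prop]
    rw [abs_le] at h1 h2 h3 h4
    -- The change of sheet is the lattice vector between the linear image of the lift and the actual
    -- lift of the image.
    refine ⟨linFlow j w - w', ?_, ?_, abs_le.1 (abs_le.2 h2)⟩
    · rw [hfin.mem_toFinset]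
      refine ⟨?_, fun h0 => hne (sub_eq_zero.1 h0).symm, ?_, ?_⟩
      · rw [map_sub, hwx', ← hwx, catMap_iterate_axes_eq, sub_self]
      · simp only [linFlow, Prod.fst_sub]
        rw [abs_le]
        constructor <;> nlinarith
      · simp only [linFlow, Prod.snd_sub]
        refine (abs_sub _ _).trans ?_
        rw [abs_mul, abs_of_pos (inv_pos.2 hl)]
        have h5 := inv_le_one_of_one_le₀ hl1
        have h6 := abs_le.2 h2
        have h7 := abs_le.2 h4
        nlinarith [abs_nonneg w.2, mul_le_mul_of_nonneg_right h5 (abs_nonneg w.2)]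
    · simp only [linFlow, Prod.fst_sub, Set.mem_Icc]
      rw [div_le_iff₀ hl, le_div_iff₀ hl]
      constructor <;> linarith
  have hbox (k : ℝ × ℝ) : volume (Set.Icc ((k.1 - E) / lam ^ j) ((k.1 + E) / lam ^ j) ×ˢ
      Set.Icc (-r) r) ≤ ENNReal.ofReal (4 * E * r / lam ^ j) := by
    rw [Measure.volume_eq_prod, Measure.prod_prod, Real.volume_Icc, Real.volume_Icc,
      ← ENNReal.ofReal_mul (by rw [← sub_div]; apply div_nonneg _ hl.le; linarith)]
    refine ENNReal.ofReal_le_ofReal (le_of_eq ?_)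
    field_simp; ring
  have hfinal := (volume_le_of_subset_image_axes hV (Finset.measurableSet_biUnion _ fun k _ =>
    measurableSet_Icc.prod measurableSet_Icc) hsub).trans
    ((measure_biUnion_finset_le _ _).trans (Finset.sum_le_card_nsmul _ _ _ fun k _ => hbox k))
  rw [nsmul_eq_mul, ← ENNReal.ofReal_natCast, ← ENNReal.ofReal_mul (by positivity)] at hfinal
  refine (ENNReal.toReal_le_of_le_ofReal (by positivity) hfinal).trans ?_
  refine (mul_le_mul_of_nonneg_right hcard (by positivity)).trans (le_of_eq ?_)
  rw [hX, hσ]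
  field_simp
  ring

/-- Being within reach after at least four expansions forces `lam * |x| < ε`. Such a point lies near
the first segment, and its next image is still above that segment. -/
lemma linFlow_one_mem_planeNhd (hε : 0 < ε) (h₁ : 0 ≤ r₁) (h₂ : 0 ≤ r₂) (h₁r : r₁ ≤ ε)
    (h₂r : r₂ ≤ ε) {j : ℕ} (hj : 4 ≤ j) {w : ℝ × ℝ} (hw : w ∈ planeNhd ε r₁ r₂)
    (hj' : linFlow j w ∈ planeNhd ε r₁ r₂) : linFlow 1 w ∈ planeNhd ε r₁ r₂ := by
  have hl := two_lt_lam
  have hl0 := lam_pos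
  have h1 := (abs_le_of_mem_planeNhd hε h₁ h₂ h₁r h₂r hj').1
  simp only [linFlow] at h1
  rw [abs_mul, abs_of_pos (pow_pos hl0 j)] at h1
  have h2 : lam ^ 4 * |w.1| ≤ lam ^ 2 * ε + ε :=
    (mul_le_mul_of_nonneg_right (pow_le_pow_right₀ (by linarith) hj) (abs_nonneg _)).trans h1
  have h3 : lam * |w.1| < ε := by
    have h4 : lam ^ 3 * (lam * |w.1|) < lam ^ 3 * ε := by
      have : lam ^ 2 * 1 + 1 < lam ^ 3 := by nlinarith [one_le_lam_pow 2]
      have := mul_lt_mul_of_pos_right this hε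
      linarith
    exact lt_of_mul_lt_mul_left h4 (by positivity)
  have h5 : |w.1| < ε := by nlinarith [abs_nonneg w.1]
  rcases hw with hw | hw
  · obtain ⟨-, hc⟩ := abs_lt_of_mem_stadium h₁ hw
    refine .inl (mem_stadium_of_mem_Ioo (abs_lt.1 ?_) ?_)
    · simp only [linFlow, pow_one]; rw [abs_mul, abs_of_pos hl0]; exact h3
    · simp only [linFlow, pow_one]
      rw [abs_mul, abs_of_pos (inv_pos.2 hl0)]
      exact (mul_le_of_le_one_left (abs_nonneg _) (inv_le_one_of_one_le₀ (by linarith))).trans_lt hc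
  · obtain ⟨⟨ha, -⟩, -⟩ := abs_lt_of_mem_stadium h₂ hw
    have := (abs_lt.1 h5).2
    nlinarith

/-- The constant in the bound for double visits. -/
def pairBound (ε : ℝ) : ℝ := 128 * reach ε ^ 2 / latticeGap

lemma pairBound_pos (hε : 0 < ε) : 0 < pairBound ε := by
  have := latticeGap_pos
  have := reach_pos hε
  unfold pairBound; positivity

/-- A return to the cluster set occurs after time `q ≥ 3`. Along the same sheet it would entail a
return at time 1, which membership excludes; so it changes sheet. -/
theorem measureReal_clusterSet_inter_preimage_le (hε : 0 < ε) (h₁ : 0 ≤ r₁) (h₂ : 0 ≤ r₂)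
    (h₁r : r₁ ≤ r) (h₂r : r₂ ≤ r) (hr : 0 < r) (hrε : r ≤ ε) (hr1 : r ≤ 1) {q : ℕ} (hq : 3 ≤ q)
    {j : ℕ} (hj : 1 ≤ j) :
    (volume : Measure Torus).real (clusterSet (torusNhd ε r₁ r₂) q ∩
      catMap^[j] ⁻¹' clusterSet (torusNhd ε r₁ r₂) q) ≤ pairBound ε * r ^ 2 := by
  have hA := measurableSet_clusterSet (measurableSet_torusNhd ε r₁ r₂) q
  refine measureReal_le_of_sheet_change
    (hA.inter ((measurePreserving_catMap.iterate j).measurable hA)) (reach_pos hε) hr j ?_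
  rintro x ⟨hx, hx'⟩
  rw [Set.mem_preimage, mem_clusterSet] at hx'
  rw [mem_clusterSet] at hx
  have hjq : q < j := by
    by_contra hle
    exact hx.2 j (Finset.mem_Icc.2 ⟨hj, not_lt.1 hle⟩) hx'.1
  obtain ⟨w, hw, hwx⟩ := hx.1
  obtain ⟨w', hw', hwx'⟩ := hx'.1
  have b := abs_le_of_mem_planeNhd hε h₁ h₂ h₁r h₂r hw
  have b' := abs_le_of_mem_planeNhd hε h₁ h₂ h₁r h₂r hw'
  unfold reach
  refine ⟨w, w', hwx, hwx', ?_, by linarith [b.1], b.2.le, by linarith [b'.1], b'.2.le⟩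
  rintro rfl
  refine hx.2 1 (Finset.mem_Icc.2 ⟨le_rfl, by omega⟩) ?_
  rw [← hwx, catMap_iterate_axes_eq]
  exact Set.mem_image_of_mem _ (linFlow_one_mem_planeNhd hε h₁ h₂ (h₁r.trans hrε)
    (h₂r.trans hrε) (by omega) hw hw')

end

noncomputable section

variable {ε r₁ r₂ r : ℝ}

/-! ### The measure of the cluster sets -/

/-- Two distinct lifts would differ by a lattice vector in a box too small for the lattice gap. The
case `i = 0` is injectivity of the covering. -/
lemma linFlow_eq_of_axes_eq (hε : 0 < ε) (h₁ : 0 ≤ r₁) (h₂ : 0 ≤ r₂) (h₁r : r₁ ≤ r) (h₂r : r₂ ≤ r)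
    (hr1 : r ≤ 1) {q : ℕ} (hrq : 4 * lam ^ q * reach ε * r ≤ latticeGap) {i : ℕ}
    (hi : i ≤ q) {w w' : ℝ × ℝ} (hw : w ∈ planeNhd ε r₁ r₂) (hw' : w' ∈ planeNhd ε r₁ r₂)
    (h : axes (linFlow i w) = axes w') : linFlow i w = w' := by
  by_contra hne
  have h1 := latticeGap_le_of_ne h hne
  have b := abs_le_of_mem_planeNhd hε h₁ h₂ h₁r h₂r hw
  have b' := abs_le_of_mem_planeNhd hε h₁ h₂ h₁r h₂r hw'
  have hR := reach_pos hε
  have hl := pow_pos lam_pos i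
  have hl1 := one_le_lam_pow i
  have hlq : lam ^ i ≤ lam ^ q := pow_le_pow_right₀ (by linarith [two_lt_lam]) hi
  have e1 : |(linFlow i w).1 - w'.1| ≤ 2 * lam ^ q * reach ε := by
    refine (abs_sub _ _).trans ?_
    simp only [linFlow]
    rw [abs_mul, abs_of_pos hl]
    have b1 : |w.1| ≤ reach ε := b.1.trans (by unfold reach; linarith)
    have b2 : |w'.1| ≤ reach ε := b'.1.trans (by unfold reach; linarith)
    have := lam_pos
    have := mul_le_mul hlq b1 (abs_nonneg _) (by positivity)
    nlinarith
  have e2 : |(linFlow i w).2 - w'.2| < 2 * r := by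
    refine (abs_sub _ _).trans_lt ?_
    simp only [linFlow]
    rw [abs_mul, abs_of_pos (inv_pos.2 hl)]
    have := mul_le_of_le_one_left (abs_nonneg w.2) (inv_le_one_of_one_le₀ hl1)
    linarith [b.2, b'.2]
  have h0 : 0 < 2 * lam ^ q * reach ε := by have := lam_pos; positivity
  have := mul_lt_mul_of_pos_left e2 h0
  have := mul_le_mul_of_nonneg_right e1 (abs_nonneg ((linFlow i w).2 - w'.2))
  linarith

lemma continuous_linFlow (i : ℕ) : Continuous (linFlow i) := by unfold linFlow; fun_prop

lemma measurableSet_planeCluster {S : Set (ℝ × ℝ)} (hS : MeasurableSet S) (q : ℕ) :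
    MeasurableSet (planeCluster S q) := by
  have : planeCluster S q = S ∩ ⋂ i ∈ Finset.Icc 1 q, linFlow i ⁻¹' Sᶜ := by
    ext w; simp [planeCluster]
  rw [this]
  exact hS.inter (Finset.measurableSet_biInter _ fun i _ =>
    (continuous_linFlow i).measurable hS.compl)

lemma measure_clusterSet_eq (hε : 0 < ε) (h₁ : 0 ≤ r₁) (h₂ : 0 ≤ r₂) (h₁r : r₁ ≤ r) (h₂r : r₂ ≤ r)
    (hr1 : r ≤ 1) {q : ℕ} (hrq : 4 * lam ^ q * reach ε * r ≤ latticeGap) :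
    volume (clusterSet (torusNhd ε r₁ r₂) q) = volume (planeCluster (planeNhd ε r₁ r₂) q) := by
  have key {i : ℕ} (hi : i ≤ q) {w w' : ℝ × ℝ} (hw : w ∈ planeNhd ε r₁ r₂)
      (hw' : w' ∈ planeNhd ε r₁ r₂) (h : axes (linFlow i w) = axes w') : linFlow i w = w' :=
    linFlow_eq_of_axes_eq hε h₁ h₂ h₁r h₂r hr1 hrq hi hw hw' h
  have himg : clusterSet (torusNhd ε r₁ r₂) q = axes '' planeCluster (planeNhd ε r₁ r₂) q := by
    ext x
    rw [mem_clusterSet]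
    constructor
    · rintro ⟨⟨w, hw, rfl⟩, hx⟩
      refine ⟨w, ⟨hw, fun i hi hi' => hx i hi ?_⟩, rfl⟩
      rw [catMap_iterate_axes_eq]
      exact Set.mem_image_of_mem _ hi'
    · rintro ⟨w, ⟨hw, hi⟩, rfl⟩
      refine ⟨Set.mem_image_of_mem _ hw, fun i hiq hmem => hi i hiq ?_⟩
      obtain ⟨w', hw', heq⟩ := hmem
      rw [catMap_iterate_axes_eq] at heq
      rwa [key (Finset.mem_Icc.1 hiq).2 hw hw' heq.symm]
  have hm := measurableSet_clusterSet (measurableSet_torusNhd ε r₁ r₂) q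
  have hp := measurableSet_planeCluster (isOpen_planeNhd ε r₁ r₂).measurableSet q
  refine le_antisymm (volume_le_of_subset_image_axes hm hp himg.le)
    (volume_le_of_image_axes_subset hm hp himg.ge ?_)
  intro w hw w' hw' heq
  have h0 : linFlow 0 w = w := by simp [linFlow]
  have := key (Nat.zero_le q) hw.1 hw'.1 (by rw [h0]; exact heq)
  rwa [h0] at this

lemma volume_linFlow_preimage (i : ℕ) (S : Set (ℝ × ℝ)) :
    volume (linFlow i ⁻¹' S) = volume S := by
  have hl := (pow_pos lam_pos i).ne'
  set f : ℝ × ℝ →ₗ[ℝ] ℝ × ℝ := Matrix.toLin (Module.Basis.finTwoProd ℝ)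
    (Module.Basis.finTwoProd ℝ) !![lam ^ i, 0; 0, (lam ^ i)⁻¹] with hf
  have hdet : LinearMap.det f = 1 := by
    rw [hf, LinearMap.det_toLin, Matrix.det_fin_two_of]; simp [hl]
  have : linFlow i = f := by
    ext w <;> rw [hf, Matrix.toLin_finTwoProd_apply] <;> simp [linFlow]
  rw [this, Measure.addHaar_preimage_linearMap _ (by rw [hdet]; exact one_ne_zero), hdet]
  simp

/-- Membership is decided by the `q + 1` positions at times `0, …, q`, and the flow preserves area.
This allows the rounded ends of the neighbourhoods to be discarded. -/
lemma volume_symmDiff_planeCluster_le (S S' : Set (ℝ × ℝ)) (q : ℕ) :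
    volume (symmDiff (planeCluster S q) (planeCluster S' q)) ≤
      (q + 1 : ℕ) * volume (symmDiff S S') := by
  have hsub : symmDiff (planeCluster S q) (planeCluster S' q) ⊆
      ⋃ i ∈ Finset.range (q + 1), linFlow i ⁻¹' symmDiff S S' := by
    intro w hw
    by_contra hno
    simp only [Set.mem_iUnion, Set.mem_preimage, exists_prop, not_exists, not_and,
      Finset.mem_range] at hno
    have hiff (i : ℕ) (hi : i ≤ q) : linFlow i w ∈ S ↔ linFlow i w ∈ S' := by
      have := hno i (by omega)
      rw [Set.mem_symmDiff] at this
      tauto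
    have h0 : linFlow 0 w = w := by simp [linFlow]
    have h00 := hiff 0 (Nat.zero_le q)
    rw [h0] at h00
    have : w ∈ planeCluster S q ↔ w ∈ planeCluster S' q := by
      refine and_congr h00 (forall₂_congr fun i hi => ?_)
      rw [hiff i (Finset.mem_Icc.1 hi).2]
    rw [Set.mem_symmDiff] at hw
    tauto
  refine (measure_mono hsub).trans ((measure_biUnion_finset_le _ _).trans ?_)
  simp only [volume_linFlow_preimage, Finset.sum_const, Finset.card_range, nsmul_eq_mul]
  exact le_rfl

/-- Half-open boxes approximating `planeNhd`. -/
def planeBoxes (ε r₁ r₂ : ℝ) : Set (ℝ × ℝ) :=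
  Set.Ico (-ε) ε ×ˢ Set.Ioo (-r₁) r₁ ∪ Set.Ico (lam * ε) (lam ^ 2 * ε) ×ˢ Set.Ioo (-r₂) r₂

lemma measurableSet_planeBoxes (ε r₁ r₂ : ℝ) : MeasurableSet (planeBoxes ε r₁ r₂) :=
  (measurableSet_Ico.prod measurableSet_Ioo).union (measurableSet_Ico.prod measurableSet_Ioo)

lemma symmDiff_stadium_subset {a b s : ℝ} (hs : 0 ≤ s) (hsr : s ≤ r) :
    symmDiff (stadium a b s) (Set.Ico a b ×ˢ Set.Ioo (-s) s) ⊆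
      Set.Icc (a - r) (a + r) ×ˢ Set.Icc (-r) r ∪ Set.Icc (b - r) (b + r) ×ˢ Set.Icc (-r) r := by
  rintro ⟨x, y⟩ (⟨hw, hn⟩ | ⟨⟨hx, hy⟩, hn⟩)
  · obtain ⟨⟨h1, h2⟩, h3⟩ := abs_lt_of_mem_stadium hs hw
    simp only at h1 h2 h3
    rw [abs_lt] at h3
    by_cases hxa : x < a
    · left; constructor <;> constructor <;> simp only <;> linarith
    · by_cases hxb : b ≤ x
      · right; constructor <;> constructor <;> simp only <;> linarith
      · exact absurd ⟨⟨not_lt.1 hxa, not_le.1 hxb⟩, h3⟩ hn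
  -- The box contains its left edge while the segment is open; only this edge can be missed.
  · have hxa : x = a := by
      by_contra hne
      exact hn (mem_stadium_of_mem_Ioo ⟨lt_of_le_of_ne hx.1 (Ne.symm hne), hx.2⟩ (abs_lt.2 hy))
    subst hxa
    simp only [Set.mem_Ioo] at hy
    left; constructor <;> constructor <;> simp only <;> linarith

lemma volume_square (a : ℝ) (hr : 0 ≤ r) :
    volume (Set.Icc (a - r) (a + r) ×ˢ Set.Icc (-r) r) = ENNReal.ofReal (4 * r ^ 2) := by
  rw [Measure.volume_eq_prod, Measure.prod_prod, Real.volume_Icc, Real.volume_Icc,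
    ← ENNReal.ofReal_mul (by linarith)]
  congr 1; ring

lemma volume_symmDiff_planeNhd_le (h₁ : 0 ≤ r₁) (h₂ : 0 ≤ r₂) (h₁r : r₁ ≤ r) (h₂r : r₂ ≤ r) :
    volume (symmDiff (planeNhd ε r₁ r₂) (planeBoxes ε r₁ r₂)) ≤ ENNReal.ofReal (16 * r ^ 2) := by
  have hr : 0 ≤ r := h₁.trans h₁r
  have hsub : symmDiff (planeNhd ε r₁ r₂) (planeBoxes ε r₁ r₂) ⊆
      symmDiff (stadium (-ε) ε r₁) (Set.Ico (-ε) ε ×ˢ Set.Ioo (-r₁) r₁) ∪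
      symmDiff (stadium (lam * ε) (lam ^ 2 * ε) r₂)
        (Set.Ico (lam * ε) (lam ^ 2 * ε) ×ˢ Set.Ioo (-r₂) r₂) := by
    intro w
    unfold planeNhd planeBoxes
    generalize stadium (-ε) ε r₁ = A
    generalize stadium (lam * ε) (lam ^ 2 * ε) r₂ = B
    generalize Set.Ico (-ε) ε ×ˢ Set.Ioo (-r₁) r₁ = C
    generalize Set.Ico (lam * ε) (lam ^ 2 * ε) ×ˢ Set.Ioo (-r₂) r₂ = D
    simp only [Set.mem_symmDiff, Set.mem_union]
    tauto
  have hu (a b s : ℝ) (hs : 0 ≤ s) (hsr : s ≤ r) :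
      volume (symmDiff (stadium a b s) (Set.Ico a b ×ˢ Set.Ioo (-s) s)) ≤
        ENNReal.ofReal (8 * r ^ 2) := by
    refine (measure_mono (symmDiff_stadium_subset hs hsr)).trans
      ((measure_union_le _ _).trans (le_of_eq ?_))
    rw [volume_square a hr, volume_square b hr, ← ENNReal.ofReal_add (by positivity) (by positivity)]
    congr 1; ring
  refine (measure_mono hsub).trans ((measure_union_le _ _).trans
    ((add_le_add (hu _ _ _ h₁ h₁r) (hu _ _ _ h₂ h₂r)).trans (le_of_eq ?_)))
  rw [← ENNReal.ofReal_add (by positivity) (by positivity)]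
  congr 1; ring

/-- The part of `planeBoxes` that does not return, when the images of the first box that land in
the second one are those with `|y| < ρ`. -/
def slabs (ε r₁ r₂ ρ : ℝ) : Set (ℝ × ℝ) :=
  Set.Ico (-ε) (-(lam⁻¹ * ε)) ×ˢ Set.Ioo (-r₁) r₁ ∪
    (Set.Ico (lam⁻¹ * ε) ε ×ˢ (Set.Ioo (-r₁) r₁ \ Set.Ioo (-ρ) ρ) ∪
      Set.Ico (lam * ε) (lam ^ 2 * ε) ×ˢ Set.Ioo (-r₂) r₂)

lemma lt_lam_inv_mul {x : ℝ} : x < lam⁻¹ * ε ↔ lam * x < ε := lt_inv_mul_iff₀ lam_pos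

lemma lam_inv_mul_le {x : ℝ} : lam⁻¹ * ε ≤ x ↔ ε ≤ lam * x := inv_mul_le_iff₀ lam_pos

lemma lt_neg_lam_inv_mul {x : ℝ} : x < -(lam⁻¹ * ε) ↔ lam * x < -ε := by
  rw [← mul_neg, lt_lam_inv_mul]

lemma abs_inv_mul_lt {c y s : ℝ} (hc : 0 < c) : -s < c⁻¹ * y ∧ c⁻¹ * y < s ↔
    -(c * s) < y ∧ y < c * s := by
  rw [lt_inv_mul_iff₀ hc, inv_mul_lt_iff₀ hc, mul_neg]

/-- Half-open boxes make the case distinction exact: `[lam⁻¹ ε, ε)` maps onto the gap `[ε, lam ε)`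
and then onto `[lam ε, lam² ε)`, the base of the second box. Nothing new happens after time 2, hence
the independence of `q ≥ 2`. -/
lemma planeCluster_planeBoxes (hε : 0 < ε) {q : ℕ} (hq : 1 ≤ q) :
    planeCluster (planeBoxes ε r₁ r₂) q =
      slabs ε r₁ r₂ (if q = 1 then 0 else lam ^ 2 * r₂) := by
  have hl := two_lt_lam
  have hl0 := lam_pos
  have hlε : ε < lam * ε := by nlinarith
  have hlε2 : lam * ε < lam ^ 2 * ε := by nlinarith
  ext ⟨x, y⟩
  simp only [planeCluster, planeBoxes, slabs, linFlow, Set.mem_union, Set.mem_prod, Set.mem_Ico,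
    Set.mem_Ioo, Set.mem_sdiff, Finset.mem_Icc, abs_inv_mul_lt (pow_pos hl0 _), lt_neg_lam_inv_mul,
    lam_inv_mul_le]
  constructor
  · rintro ⟨⟨hx, hy⟩ | h, hi⟩
    · have h1 := hi 1 ⟨le_rfl, hq⟩
      rw [pow_one] at h1
      have hr₁ : 0 < r₁ := by linarith [hy.1, hy.2]
      have hy1 : -(lam * r₁) < y ∧ y < lam * r₁ := ⟨by nlinarith, by nlinarith⟩
      by_cases hneg : lam * x < -ε
      · exact .inl ⟨⟨hx.1, hneg⟩, hy⟩
      · have hge : ε ≤ lam * x := by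
          by_contra hlt
          exact h1 (.inl ⟨⟨not_lt.1 hneg, not_le.1 hlt⟩, hy1⟩)
        refine .inr (.inl ⟨⟨hge, hx.2⟩, hy, ?_⟩)
        -- For `q = 1` the second box is not yet reached; the width is then `0` and the removed
        -- interval is empty.
        split_ifs with hq1
        · rintro ⟨h3, h4⟩; linarith
        · intro h3
          refine hi 2 ⟨by norm_num, by omega⟩ (.inr ⟨⟨by nlinarith, ?_⟩, h3⟩)
          exact mul_lt_mul_of_pos_left hx.2 (by positivity)
    · exact .inr (.inr h)
  · have hfar {i : ℕ} (h : lam ^ 2 * ε ≤ lam ^ i * x) : ¬ ((( -ε ≤ lam ^ i * x ∧ lam ^ i * x < ε) ∧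
        -(lam ^ i * r₁) < y ∧ y < lam ^ i * r₁) ∨ (lam * ε ≤ lam ^ i * x ∧ lam ^ i * x < lam ^ 2 * ε) ∧
        -(lam ^ i * r₂) < y ∧ y < lam ^ i * r₂) := by
      rintro (h | h)
      · linarith [h.1.2]
      · linarith [h.1.2]
    rintro (⟨⟨hx, hx'⟩, hy⟩ | ⟨⟨hx, hx'⟩, hy, hρ⟩ | ⟨⟨hx, hx'⟩, hy⟩)
    · refine ⟨.inl ⟨⟨hx, by nlinarith⟩, hy⟩, fun i hi => ?_⟩
      have hi' : lam ^ i * x < -ε := by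
        obtain ⟨k, rfl⟩ := Nat.exists_eq_add_of_le hi.1
        rw [pow_add, pow_one]
        nlinarith [one_le_lam_pow k]
      rintro (h | h)
      · linarith [h.1.1]
      · linarith [h.1.1]
    · refine ⟨.inl ⟨⟨by nlinarith, hx'⟩, hy⟩, fun i hi => ?_⟩
      have hx0 : 0 < x := by nlinarith
      rcases (show i = 1 ∨ i = 2 ∨ 3 ≤ i by omega) with rfl | rfl | h3
      · rw [pow_one]
        rintro (h | h)
        · linarith [h.1.2]
        · have := h.1.1; nlinarith
      · rw [if_neg (by omega)] at hρ
        rintro (h | h)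
        · have := h.1.2; nlinarith
        · exact hρ h.2
      · refine hfar ?_
        obtain ⟨k, rfl⟩ := Nat.exists_eq_add_of_le h3
        have e1 : lam ^ 2 * ε ≤ lam ^ 2 * (lam * x) := mul_le_mul_of_nonneg_left hx (by positivity)
        have e2 := mul_le_mul_of_nonneg_right (one_le_lam_pow k)
          (show 0 ≤ lam ^ 2 * (lam * x) by positivity)
        rw [pow_add]
        linarith
    · refine ⟨.inr ⟨⟨hx, hx'⟩, hy⟩, fun i hi => hfar ?_⟩
      obtain ⟨k, rfl⟩ := Nat.exists_eq_add_of_le hi.1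
      have hx0 : 0 < x := by nlinarith
      have e1 : lam ^ 2 * ε ≤ lam * x := by nlinarith
      have e2 := mul_le_mul_of_nonneg_right (one_le_lam_pow k) (show 0 ≤ lam * x by positivity)
      rw [pow_add]
      linarith

lemma measureReal_Ioo_diff_Ioo {s ρ : ℝ} (hs : 0 ≤ s) (hρ : 0 ≤ ρ) :
    (volume : Measure ℝ).real (Set.Ioo (-s) s \ Set.Ioo (-ρ) ρ) = 2 * max (s - ρ) 0 := by
  rcases le_total s ρ with h | h
  · rw [Set.sdiff_eq_empty.2 (Set.Ioo_subset_Ioo (by linarith) h), max_eq_right (by linarith)]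
    simp
  · rw [measureReal_sdiff (Set.Ioo_subset_Ioo (by linarith) h) measurableSet_Ioo
      (by rw [Real.volume_Ioo]; exact ENNReal.ofReal_ne_top),
      Real.volume_real_Ioo_of_le (by linarith), Real.volume_real_Ioo_of_le (by linarith),
      max_eq_left (by linarith)]
    ring

lemma measureReal_prod_set (A B : Set ℝ) :
    (volume : Measure (ℝ × ℝ)).real (A ×ˢ B) =
      (volume : Measure ℝ).real A * (volume : Measure ℝ).real B := by
  rw [Measure.volume_eq_prod, measureReal_prod_prod]

lemma volume_Ico_prod_ne_top (a b : ℝ) {B : Set ℝ} {s : ℝ} (hB : B ⊆ Set.Ioo (-s) s) :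
    volume (Set.Ico a b ×ˢ B) ≠ ∞ := by
  refine ne_top_of_le_ne_top ?_ (measure_mono (Set.prod_mono_right hB))
  rw [Measure.volume_eq_prod, Measure.prod_prod, Real.volume_Ico, Real.volume_Ioo]
  exact ENNReal.mul_ne_top ENNReal.ofReal_ne_top ENNReal.ofReal_ne_top

lemma measureReal_slabs (hε : 0 < ε) (h₁ : 0 ≤ r₁) (h₂ : 0 ≤ r₂) {ρ : ℝ} (hρ : 0 ≤ ρ) :
    (volume : Measure (ℝ × ℝ)).real (slabs ε r₁ r₂ ρ) =
      2 * ε * (1 - lam⁻¹) * (r₁ + max (r₁ - ρ) 0) + 2 * (lam ^ 2 - lam) * ε * r₂ := by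
  have hl := two_lt_lam
  have hl0 := lam_pos
  have hinv : lam⁻¹ * ε < ε := by rw [inv_mul_lt_iff₀ hl0]; nlinarith
  have hinv0 : 0 < lam⁻¹ * ε := by positivity
  have hlε : ε < lam * ε := by nlinarith
  have hlε2 : lam * ε < lam ^ 2 * ε := by nlinarith
  have m1 : MeasurableSet (Set.Ico (lam⁻¹ * ε) ε ×ˢ (Set.Ioo (-r₁) r₁ \ Set.Ioo (-ρ) ρ)) :=
    measurableSet_Ico.prod (measurableSet_Ioo.diff measurableSet_Ioo)
  have m2 : MeasurableSet (Set.Ico (lam * ε) (lam ^ 2 * ε) ×ˢ Set.Ioo (-r₂) r₂) :=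
    measurableSet_Ico.prod measurableSet_Ioo
  have f1 := volume_Ico_prod_ne_top (-ε) (-(lam⁻¹ * ε)) (subset_refl (Set.Ioo (-r₁) r₁))
  have f2 := volume_Ico_prod_ne_top (lam⁻¹ * ε) ε
    (Set.sdiff_subset : Set.Ioo (-r₁) r₁ \ Set.Ioo (-ρ) ρ ⊆ _)
  have f3 := volume_Ico_prod_ne_top (lam * ε) (lam ^ 2 * ε) (subset_refl (Set.Ioo (-r₂) r₂))
  rw [slabs, measureReal_union ?_ (m1.union m2) f1 (measure_union_ne_top f2 f3),
    measureReal_union ?_ m2 f2 f3]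
  · simp only [measureReal_prod_set, measureReal_Ioo_diff_Ioo h₁ hρ]
    rw [Real.volume_real_Ico_of_le (by linarith), Real.volume_real_Ico_of_le (by linarith),
      Real.volume_real_Ico_of_le (by linarith), Real.volume_real_Ioo_of_le (by linarith),
      Real.volume_real_Ioo_of_le (by linarith)]
    ring
  · refine Set.disjoint_left.2 fun w hw hw' => ?_
    have := hw.1.2; have := hw'.1.1
    linarith
  · refine Set.disjoint_left.2 fun w hw hw' => ?_
    have := hw.1.2
    rcases hw' with hw' | hw'
    · have := hw'.1.1; linarith
    · have := hw'.1.1; linarith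

lemma measureReal_planeBoxes (hε : 0 < ε) (h₁ : 0 ≤ r₁) (h₂ : 0 ≤ r₂) :
    (volume : Measure (ℝ × ℝ)).real (planeBoxes ε r₁ r₂) =
      4 * ε * r₁ + 2 * (lam ^ 2 - lam) * ε * r₂ := by
  have hl := two_lt_lam
  have hlε : ε < lam * ε := by nlinarith
  have hlε2 : lam * ε < lam ^ 2 * ε := by nlinarith
  rw [planeBoxes, measureReal_union ?_ (measurableSet_Ico.prod measurableSet_Ioo)
    (volume_Ico_prod_ne_top _ _ (subset_refl _)) (volume_Ico_prod_ne_top _ _ (subset_refl _))]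
  · simp only [measureReal_prod_set]
    rw [Real.volume_real_Ico_of_le (by linarith), Real.volume_real_Ico_of_le (by linarith),
      Real.volume_real_Ioo_of_le (by linarith), Real.volume_real_Ioo_of_le (by linarith)]
    ring
  · refine Set.disjoint_left.2 fun w hw hw' => ?_
    have := hw.1.2; have := hw'.1.1
    linarith

/-- The measure of `clusterSet (torusNhd ε r₁ r₂) q`, to first order in the radii. -/
def clusterArea (ε : ℝ) (q : ℕ) (r₁ r₂ : ℝ) : ℝ :=
  if q = 0 then 4 * ε * r₁ + 2 * (lam ^ 2 - lam) * ε * r₂ else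
    2 * ε * (1 - lam⁻¹) * (r₁ + max (r₁ - if q = 1 then 0 else lam ^ 2 * r₂) 0) +
      2 * (lam ^ 2 - lam) * ε * r₂

/-- Lifting is exact for small radii, so the error comes only from the ends of the segments, each
contributing `O(r²)` at each of `q + 1` times. It is negligible after multiplication by `n`, as `r =
O(1 / n)`. -/
theorem abs_measureReal_clusterSet_sub_le (hε : 0 < ε) (h₁ : 0 ≤ r₁) (h₂ : 0 ≤ r₂) (h₁r : r₁ ≤ r)
    (h₂r : r₂ ≤ r) (hr1 : r ≤ 1) {q : ℕ}
    (hrq : 4 * lam ^ q * reach ε * r ≤ latticeGap) :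
    |(volume : Measure Torus).real (clusterSet (torusNhd ε r₁ r₂) q) - clusterArea ε q r₁ r₂| ≤
      16 * (q + 1) * r ^ 2 := by
  have hbox : clusterArea ε q r₁ r₂ =
      (volume : Measure (ℝ × ℝ)).real (planeCluster (planeBoxes ε r₁ r₂) q) := by
    rw [clusterArea]
    split_ifs with h0 h1
    · subst h0
      have : planeCluster (planeBoxes ε r₁ r₂) 0 = planeBoxes ε r₁ r₂ := by
        ext w; simp [planeCluster]
      rw [this, measureReal_planeBoxes hε h₁ h₂]
    · rw [planeCluster_planeBoxes hε (by omega), if_pos h1, measureReal_slabs hε h₁ h₂ le_rfl]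
    · rw [planeCluster_planeBoxes hε (by omega), if_neg h1,
        measureReal_slabs hε h₁ h₂ (by positivity)]
  have hsd := (volume_symmDiff_planeCluster_le (planeNhd ε r₁ r₂) (planeBoxes ε r₁ r₂) q).trans
    (mul_le_mul_right (volume_symmDiff_planeNhd_le h₁ h₂ h₁r h₂r) _)
  rw [← ENNReal.ofReal_natCast, ← ENNReal.ofReal_mul (by positivity)] at hsd
  rw [hbox, measureReal_def, measure_clusterSet_eq hε h₁ h₂ h₁r h₂r hr1 hrq]
  have hfb : volume (planeCluster (planeBoxes ε r₁ r₂) q) ≠ ∞ := by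
    refine ne_top_of_le_ne_top ?_ (measure_mono fun w hw => hw.1)
    exact measure_union_ne_top (volume_Ico_prod_ne_top _ _ (subset_refl _))
      (volume_Ico_prod_ne_top _ _ (subset_refl _))
  have hfn : volume (planeCluster (planeNhd ε r₁ r₂) q) ≠ ∞ := by
    rw [← measure_clusterSet_eq hε h₁ h₂ h₁r h₂r hr1 hrq]
    exact measure_ne_top _ _
  refine (abs_measureReal_sub_le_measureReal_symmDiff'
    (measurableSet_planeCluster (isOpen_planeNhd ε r₁ r₂).measurableSet q).nullMeasurableSet
    (measurableSet_planeCluster (measurableSet_planeBoxes ε r₁ r₂) q).nullMeasurableSet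
    hfn hfb).trans ?_
  refine (ENNReal.toReal_le_of_le_ofReal (by positivity) hsd).trans (le_of_eq ?_)
  push_cast; ring

end

noncomputable section

/-! ### Level sets of the observables -/

lemma lt_shapeLog_iff (u t : ℝ) : (u : EReal) < shapeLog t ↔ t < Real.exp (-u) := by
  rw [shapeLog, EReal.lt_neg_comm, ← EReal.coe_neg, ← ENNReal.ofReal_lt_ofReal_iff (Real.exp_pos _),
    ← ENNReal.log_lt_log_iff, ENNReal.log_ofReal_of_pos (Real.exp_pos _), Real.log_exp]

lemma lt_shapePower_iff {α : ℝ} (hα : 0 < α) {u : ℝ} (hu : 0 < u) (t : ℝ) :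
    (u : EReal) < shapePower α t ↔ t < u⁻¹ ^ α := by
  have h1 : ((ENNReal.ofReal u : ℝ≥0∞) : EReal) = u := by
    rw [EReal.coe_ennreal_ofReal, max_eq_left hu.le]
  rw [shapePower, ← h1, EReal.coe_ennreal_lt_coe_ennreal_iff, ENNReal.rpow_neg,
    ENNReal.lt_inv_iff_lt_inv, one_div, ENNReal.rpow_inv_lt_iff hα,
    ← ENNReal.ofReal_inv_of_pos hu, ENNReal.ofReal_rpow_of_pos (inv_pos.2 hu),
    ENNReal.ofReal_lt_ofReal_iff (by positivity)]

lemma lt_shapePower_of_nonpos {α : ℝ} {u : ℝ} (hα : 0 < α) (hu : u ≤ 0) (t : ℝ) :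
    (u : EReal) < shapePower α t := by
  have h1 : (u : EReal) ≤ 0 := by exact_mod_cast hu
  refine h1.trans_lt ?_
  rw [shapePower, ← EReal.coe_ennreal_zero, EReal.coe_ennreal_lt_coe_ennreal_iff, ENNReal.rpow_neg,
    ENNReal.inv_pos]
  exact ENNReal.rpow_ne_top_of_nonneg (by positivity) ENNReal.ofReal_ne_top

lemma lt_shapeBounded_iff {D α : ℝ} (hα : 0 < α) {u : ℝ} (hu : u ≤ D) {t : ℝ} (ht : 0 ≤ t) :
    (u : EReal) < shapeBounded D α t ↔ t < (D - u) ^ α := by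
  rw [shapeBounded, EReal.coe_lt_coe_iff, one_div,
    ← Real.rpow_inv_lt_iff_of_pos ht (by linarith) hα]
  constructor <;> intro h <;> linarith

lemma IsShape.exists_radius {g : ℝ → EReal} (hg : IsShape g) (u : ℝ) :
    ∃ r, 0 ≤ r ∧ ∀ t, 0 ≤ t → t ≤ 1 → ((u : EReal) < g t ↔ t < r) := by
  rcases hg with rfl | ⟨α, hα, rfl⟩ | ⟨D, α, hα, rfl⟩
  · exact ⟨_, (Real.exp_pos (-u)).le, fun t _ _ => lt_shapeLog_iff u t⟩
  · rcases le_or_gt u 0 with hu | hu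
    -- A nonpositive level is exceeded everywhere; any radius above 1 describes this on the torus.
    · exact ⟨2, by norm_num, fun t _ ht1 => iff_of_true (lt_shapePower_of_nonpos hα hu t)
        (by linarith)⟩
    · exact ⟨u⁻¹ ^ α, by positivity, fun t _ _ => lt_shapePower_iff hα hu t⟩
  · rcases le_or_gt u D with hu | hu
    · exact ⟨(D - u) ^ α, Real.rpow_nonneg (by linarith) _,
        fun t ht _ => lt_shapeBounded_iff hα hu ht⟩
    · refine ⟨0, le_rfl, fun t ht _ => iff_of_false ?_ (not_lt.2 ht)⟩
      rw [shapeBounded, EReal.coe_lt_coe_iff, not_lt]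
      linarith [Real.rpow_nonneg ht (1 / α)]

lemma IsShape.exists_level {g : ℝ → EReal} (hg : IsShape g) {r : ℝ} (hr : 0 < r) :
    ∃ u : ℝ, ∀ t, 0 ≤ t → ((u : EReal) < g t ↔ t < r) := by
  rcases hg with rfl | ⟨α, hα, rfl⟩ | ⟨D, α, hα, rfl⟩
  · refine ⟨-Real.log r, fun t _ => ?_⟩
    rw [lt_shapeLog_iff, neg_neg, Real.exp_log hr]
  · refine ⟨(r ^ α⁻¹)⁻¹, fun t _ => ?_⟩
    rw [lt_shapePower_iff hα (by positivity), inv_inv, Real.rpow_inv_rpow hr.le hα.ne']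
  · refine ⟨D - r ^ α⁻¹, fun t ht => ?_⟩
    rw [lt_shapeBounded_iff hα (by linarith [Real.rpow_pos_of_pos hr α⁻¹]) ht, sub_sub_cancel,
      Real.rpow_inv_rpow hr.le hα.ne']

lemma IsShape.measurable {g : ℝ → EReal} (hg : IsShape g) : Measurable g := by
  rcases hg with rfl | ⟨α, hα, rfl⟩ | ⟨D, α, hα, rfl⟩
  · exact (ENNReal.measurable_log.comp ENNReal.measurable_ofReal).neg
  · exact measurable_coe_ennreal_ereal.comp (ENNReal.measurable_ofReal.pow_const _)
  · exact measurable_coe_real_ereal.comp (measurable_const.sub (measurable_id.pow_const _))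

/-- The left endpoints of the two segments. -/
def segLeft (ε : ℝ) : Fin 2 → ℝ := ![-ε, lam * ε]

/-- The right endpoints of the two segments. -/
def segRight (ε : ℝ) : Fin 2 → ℝ := ![ε, lam ^ 2 * ε]

lemma segLeft_lt_segRight {ε : ℝ} (hε : 0 < ε) (i : Fin 2) : segLeft ε i < segRight ε i := by
  have := two_lt_lam
  have : lam * ε < lam ^ 2 * ε := by
    have := mul_pos lam_pos hε
    nlinarith
  fin_cases i <;> simp [segLeft, segRight] <;> linarith

lemma extremalSet_eq (ε : ℝ) (i : Fin 2) :
    extremalSet ε i = unstablePoint '' Set.Ioo (segLeft ε i) (segRight ε i) := by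
  fin_cases i <;> rfl

lemma extremalSet_nonempty {ε : ℝ} (hε : 0 < ε) (i : Fin 2) : (extremalSet ε i).Nonempty := by
  rw [extremalSet_eq]
  exact (Set.nonempty_Ioo.2 (segLeft_lt_segRight hε i)).image _

/-- The neighbourhood of radius `r` of the `i`-th segment in the torus. -/
def segNhd (ε : ℝ) (i : Fin 2) (r : ℝ) : Set Torus :=
  axes '' stadium (segLeft ε i) (segRight ε i) r

lemma setOf_lt_observable {ε : ℝ} (hε : 0 < ε) {g : Fin 2 → ℝ → EReal} {i : Fin 2} {u r : ℝ}
    (hr : 0 ≤ r) (h : ∀ t, 0 ≤ t → t ≤ 1 → ((u : EReal) < g i t ↔ t < r)) :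
    {x | (u : EReal) < observable ε g x i} = segNhd ε i r := by
  rw [segNhd, ← setOf_distTo_lt (segLeft_lt_segRight hε i) hr, ← extremalSet_eq]
  ext x
  exact h _ (distTo_nonneg _ _) (distTo_le_one _ (extremalSet_nonempty hε i))

lemma measurable_observable {ε : ℝ} (hε : 0 < ε) {g : Fin 2 → ℝ → EReal}
    (hg : ∀ i, IsShape (g i)) : Measurable (observable ε g) :=
  measurable_pi_iff.2 fun i => (hg i).measurable.comp
    (measurable_distTo (extremalSet_nonempty hε i))

/-! ### The events of the process -/

section Events

variable {Ψ : Torus → Fin 2 → EReal} {v : Fin 2 → ℝ}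

lemma mem_exceed {x : Torus} : x ∈ exceed catMap Ψ v ↔ ∃ j, (v j : EReal) < Ψ x j := by
  simp only [exceed, process, toEVec, Pi.le_def, Set.mem_ofPred_eq, not_forall, not_le,
    Function.iterate_zero, id_eq]

lemma exceed_eq : exceed catMap Ψ v =
    {x | (v 0 : EReal) < Ψ x 0} ∪ {x | (v 1 : EReal) < Ψ x 1} := by
  ext x
  rw [mem_exceed, Fin.exists_fin_two]; rfl

lemma maxLE_eq (n : ℕ) : maxLE catMap Ψ n v =
    ⋂ i ∈ Finset.range n, catMap^[i] ⁻¹' (exceed catMap Ψ v)ᶜ := by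
  ext x
  simp only [maxLE, maxima, Set.mem_ofPred_eq, Pi.le_def, toEVec, Finset.sup_le_iff, process,
    Set.mem_iInter, Set.mem_preimage, Set.mem_compl_iff, mem_exceed, not_exists, not_lt]
  exact ⟨fun h i hi j => h j i hi, fun h j i hi => h i hi j⟩

lemma clusterEnd_eq (q : ℕ) : clusterEnd catMap Ψ q v = clusterSet (exceed catMap Ψ v) q := by
  ext x
  rw [mem_clusterSet, clusterEnd, maxLE_eq]
  simp only [Set.mem_inter_iff, Set.mem_preimage, Set.mem_iInter, Set.mem_compl_iff,
    Finset.mem_range, Finset.mem_Icc, ← Function.iterate_succ_apply]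
  refine and_congr_right fun _ => ⟨fun h i hi => ?_, fun h i hi => h (i + 1) ⟨by omega, by omega⟩⟩
  obtain ⟨k, rfl⟩ := Nat.exists_eq_add_of_le' hi.1
  exact h k (by omega)

end Events

/-- With truncated subtraction, `ℓ - 1 + 1` equals `ℓ` only for `ℓ ≥ 1`; this form holds for every
`ℓ`. -/
lemma avoid_eq (s ℓ : ℕ) (B : Set Torus) : avoid catMap s ℓ B =
    catMap^[s] ⁻¹' ⋂ i ∈ Finset.range (ℓ - 1 + 1), catMap^[i] ⁻¹' Bᶜ := by
  ext x
  simp only [avoid, Set.mem_iInter, Set.mem_preimage, Finset.mem_Icc, Finset.mem_range,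
    ← Function.iterate_add_apply]
  refine ⟨fun h i hi => h (i + s) ⟨by omega, by omega⟩, fun h i hi => ?_⟩
  obtain ⟨k, rfl⟩ := Nat.exists_eq_add_of_le' hi.1
  exact h k (by omega)

lemma torusNhd_eq (ε r₁ r₂ : ℝ) : torusNhd ε r₁ r₂ = segNhd ε 0 r₁ ∪ segNhd ε 1 r₂ := by
  rw [torusNhd, planeNhd, Set.image_union]; rfl

/-! ### The law of the maximum -/

/-- An elementary Poisson-type estimate: if double visits are rare and the future decouples, then
the probability of no visit to `A` up to time `n` is close to `(1 - μ A) ^ n`. -/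
theorem abs_measureReal_sub_pow_le {A : Set Torus} (hA : MeasurableSet A) {η γ : ℝ}
    {t : ℕ} (ht : 1 ≤ t) (hpair : ∀ j, 1 ≤ j →
      (volume : Measure Torus).real (A ∩ catMap^[j] ⁻¹' A) ≤ η)
    (hmix : ∀ m : ℕ, |(volume : Measure Torus).real
        (A ∩ catMap^[t] ⁻¹' ⋂ i ∈ Finset.range m, catMap^[i] ⁻¹' Aᶜ) -
      (volume : Measure Torus).real A *
        (volume : Measure Torus).real (⋂ i ∈ Finset.range m, catMap^[i] ⁻¹' Aᶜ)| ≤ γ) (n : ℕ) :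
    |(volume : Measure Torus).real (⋂ i ∈ Finset.range n, catMap^[i] ⁻¹' Aᶜ) -
      (1 - (volume : Measure Torus).real A) ^ n| ≤ n * (2 * t * η + γ) := by
  set W : ℕ → Set Torus := fun m => ⋂ i ∈ Finset.range m, catMap^[i] ⁻¹' Aᶜ with hW
  have hWm (m : ℕ) : MeasurableSet (W m) := measurableSet_biInter_iterate hA.compl _
  have hη : 0 ≤ η := measureReal_nonneg.trans (hpair 1 le_rfl)
  have hpre (j m : ℕ) : MeasurableSet (catMap^[j] ⁻¹' W m) :=
    (measurePreserving_catMap.iterate j).measurable (hWm m)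
  have hmemW {m : ℕ} {x : Torus} : x ∈ W m ↔ ∀ i < m, catMap^[i] x ∉ A := by simp [hW]
  have hmem {j m : ℕ} {x : Torus} :
      x ∈ catMap^[j] ⁻¹' W m ↔ ∀ i < m, catMap^[i + j] x ∉ A := by
    rw [Set.mem_preimage, hmemW]; simp only [Function.iterate_add_apply]
  have hgap (m : ℕ) : |(volume : Measure Torus).real (A ∩ catMap^[1] ⁻¹' W m) -
      (volume : Measure Torus).real (A ∩ catMap^[t] ⁻¹' W m)| ≤ 2 * t * η := by
    refine (abs_measureReal_sub_le_measureReal_symmDiff (hA.inter (hpre _ _)).nullMeasurableSet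
      (hA.inter (hpre _ _)).nullMeasurableSet).trans ?_
    -- The windows `[1, m]` and `[t, t + m - 1]` can differ only at times in `[1, t]` or `[m + 1, m
    -- + t]`. A visit there, starting from `A`, is one of at most `2 * t` double visits.
    have hsub : symmDiff (A ∩ catMap^[1] ⁻¹' W m) (A ∩ catMap^[t] ⁻¹' W m) ⊆
        ⋃ j ∈ (Finset.Icc 1 t ∪ Finset.Ico (m + 1) (m + 1 + t)), A ∩ catMap^[j] ⁻¹' A := by
      intro x hx
      by_contra hno
      have hxA : x ∈ A := by
        rcases hx with h | h
        · exact h.1.1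
        · exact h.1.1
      simp only [Set.mem_iUnion, exists_prop, not_exists, not_and, Finset.mem_union, Finset.mem_Icc,
        Finset.mem_Ico, Set.mem_inter_iff, Set.mem_preimage] at hno
      have hno' (j : ℕ) (hj : 1 ≤ j ∧ j ≤ t ∨ m + 1 ≤ j ∧ j < m + 1 + t) : catMap^[j] x ∉ A :=
        hno j hj hxA
      rcases hx with ⟨⟨-, h1⟩, h2⟩ | ⟨⟨-, h1⟩, h2⟩
      · refine h2 ⟨hxA, hmem.2 fun i hi => ?_⟩
        rw [hmem] at h1
        by_cases hj : 1 ≤ i + t ∧ i + t < m + 1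
        · have := h1 (i + t - 1) (by omega)
          rwa [Nat.sub_add_cancel hj.1] at this
        · exact hno' _ (.inr (by omega))
      · refine h2 ⟨hxA, hmem.2 fun i hi => ?_⟩
        rw [hmem] at h1
        by_cases hj : t < i + 1
        · have := h1 (i + 1 - t) (by omega)
          rwa [Nat.sub_add_cancel hj.le] at this
        · exact hno' _ (.inl (by omega))
    refine (measureReal_mono hsub (measure_ne_top _ _)).trans
      ((measureReal_biUnion_finset_le _ _).trans
      ((Finset.sum_le_card_nsmul _ _ η fun j hj => hpair j ?_).trans ?_))
    · rw [Finset.mem_union, Finset.mem_Icc, Finset.mem_Ico] at hj; omega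
    · rw [nsmul_eq_mul]
      refine mul_le_mul_of_nonneg_right ?_ hη
      have := Finset.card_union_le (Finset.Icc 1 t) (Finset.Ico (m + 1) (m + 1 + t))
      rw [Nat.card_Icc, Nat.card_Ico] at this
      have h2 : (Finset.Icc 1 t ∪ Finset.Ico (m + 1) (m + 1 + t)).card ≤ 2 * t := by omega
      exact_mod_cast h2
  set p := (volume : Measure Torus).real A with hp
  have hp0 : 0 ≤ p := measureReal_nonneg
  have hp1 : p ≤ 1 := measureReal_le_one
  have hrec (m : ℕ) : (volume : Measure Torus).real (W (m + 1)) =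
      (volume : Measure Torus).real (W m) -
        (volume : Measure Torus).real (A ∩ catMap^[1] ⁻¹' W m) := by
    have h1 : W (m + 1) = catMap^[1] ⁻¹' W m \ A := by
      ext x
      rw [Set.mem_sdiff, hmem, hmemW]
      constructor
      · exact fun h => ⟨fun i hi => h (i + 1) (by omega), h 0 (by omega)⟩
      · rintro ⟨h, h0⟩ i hi
        rcases i with _ | i
        · exact h0
        · exact h i (by omega)
    have h2 := measureReal_sdiff_add_inter (μ := (volume : Measure Torus)) (s := catMap^[1] ⁻¹' W m)
      hA
    rw [(measurePreserving_catMap.iterate 1).measureReal_preimage (hWm m).nullMeasurableSet,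
      Set.inter_comm] at h2
    rw [h1]
    linarith
  induction n with
  | zero => simp
  | succ n ih =>
    have h1 := hgap n
    have h2 := hmix n
    have h3 := hrec n
    change |(volume : Measure Torus).real (W n) - _| ≤ _ at ih
    change |(volume : Measure Torus).real (W (n + 1)) - _| ≤ _
    change |(volume : Measure Torus).real (A ∩ catMap^[t] ⁻¹' W n) -
      p * (volume : Measure Torus).real (W n)| ≤ γ at h2
    -- Conditioning on the first time gives this recursion. The old error is multiplied by `1 - p ≤
    -- 1`, so the gap and mixing errors simply add up.
    have e : (volume : Measure Torus).real (W (n + 1)) - (1 - p) ^ (n + 1) =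
        (1 - p) * ((volume : Measure Torus).real (W n) - (1 - p) ^ n) -
        (((volume : Measure Torus).real (A ∩ catMap^[1] ⁻¹' W n) -
          (volume : Measure Torus).real (A ∩ catMap^[t] ⁻¹' W n)) +
        ((volume : Measure Torus).real (A ∩ catMap^[t] ⁻¹' W n) -
          p * (volume : Measure Torus).real (W n))) := by
      rw [h3, pow_succ]; ring
    rw [e]
    refine (abs_sub _ _).trans ?_
    have h4 := (abs_add_le ((volume : Measure Torus).real (A ∩ catMap^[1] ⁻¹' W n) -
      (volume : Measure Torus).real (A ∩ catMap^[t] ⁻¹' W n)) _).trans (add_le_add h1 h2)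
    have h5 : |(1 - p) * ((volume : Measure Torus).real (W n) - (1 - p) ^ n)| ≤
        n * (2 * t * η + γ) := by
      rw [abs_mul, abs_of_nonneg (by linarith : 0 ≤ 1 - p)]
      exact (mul_le_of_le_one_left (abs_nonneg _) (by linarith)).trans ih
    push_cast
    linarith

/-- The last visit to `U` before time `n` is followed by `q` free steps unless it falls in the final
`q` times. -/
lemma abs_measureReal_avoid_sub_clusterSet_le {U : Set Torus} (hU : MeasurableSet U) (q n : ℕ) :
    |(volume : Measure Torus).real (⋂ i ∈ Finset.range n, catMap^[i] ⁻¹' Uᶜ) -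
      (volume : Measure Torus).real (⋂ i ∈ Finset.range n, catMap^[i] ⁻¹' (clusterSet U q)ᶜ)| ≤
      q * (volume : Measure Torus).real U := by
  refine (abs_measureReal_sub_le_measureReal_symmDiff
    (measurableSet_biInter_iterate hU.compl _).nullMeasurableSet
    (measurableSet_biInter_iterate (measurableSet_clusterSet hU q).compl _).nullMeasurableSet).trans ?_
  have hsub : symmDiff (⋂ i ∈ Finset.range n, catMap^[i] ⁻¹' Uᶜ)
      (⋂ i ∈ Finset.range n, catMap^[i] ⁻¹' (clusterSet U q)ᶜ) ⊆
      ⋃ i ∈ Finset.Ico (n - q) n, catMap^[i] ⁻¹' U := by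
    intro x hx
    simp only [Set.mem_symmDiff, Set.mem_iInter, Finset.mem_range, Set.mem_preimage,
      Set.mem_compl_iff] at hx
    simp only [Set.mem_iUnion, Finset.mem_Ico, Set.mem_preimage, exists_prop]
    rcases hx with ⟨h1, h2⟩ | ⟨h1, h2⟩
    · exact absurd (fun i hi h => h1 i hi (mem_clusterSet.1 h).1) h2
    · push Not at h2
      by_contra hno
      push Not at hno
      obtain ⟨i₀, hi₀, hU₀⟩ := h2
      set P : ℕ → Prop := fun i => i < n ∧ catMap^[i] x ∈ U
      classical
      -- The last visit before time `n`.
      set i := Nat.findGreatest P n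
      have hP : P i := Nat.findGreatest_spec (P := P) hi₀.le ⟨hi₀, hU₀⟩
      have hmax (k : ℕ) (hk : i < k) (hkn : k < n) : catMap^[k] x ∉ U := fun h =>
        Nat.findGreatest_is_greatest hk hkn.le ⟨hkn, h⟩
      refine h1 i hP.1 (mem_clusterSet.2 ⟨hP.2, fun k hk => ?_⟩)
      rw [Finset.mem_Icc] at hk
      rw [← Function.iterate_add_apply]
      have hiq : i < n - q := by
        by_contra hge
        exact hno i ⟨not_lt.1 hge, hP.1⟩ hP.2
      exact hmax _ (by omega) (by omega)
  refine (measureReal_mono hsub (measure_ne_top _ _)).trans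
    ((measureReal_biUnion_finset_le _ _).trans ?_)
  simp only [(measurePreserving_catMap.iterate _).measureReal_preimage hU.nullMeasurableSet,
    Finset.sum_const, Nat.card_Ico, nsmul_eq_mul]
  refine mul_le_mul_of_nonneg_right ?_ measureReal_nonneg
  exact_mod_cast (by omega : n - (n - q) ≤ q)

end

noncomputable section

/-! ### Asymptotics -/

lemma tendsto_zero_of_tendsto_natCast_mul {x : ℕ → ℝ} {c : ℝ}
    (h : Tendsto (fun n : ℕ => (n : ℝ) * x n) atTop (𝓝 c)) : Tendsto x atTop (𝓝 0) := by
  have h1 := h.mul (tendsto_inv_atTop_zero.comp (tendsto_natCast_atTop_atTop (R := ℝ)))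
  rw [mul_zero] at h1
  refine h1.congr' ?_
  filter_upwards [eventually_ge_atTop 1] with n hn
  have : (n : ℝ) ≠ 0 := by positivity
  simp only [Function.comp]
  field_simp

lemma tendsto_natCast_mul_sq {x : ℕ → ℝ} {c : ℝ}
    (h : Tendsto (fun n : ℕ => (n : ℝ) * x n) atTop (𝓝 c)) :
    Tendsto (fun n : ℕ => (n : ℝ) * x n ^ 2) atTop (𝓝 0) := by
  have h1 := h.mul (tendsto_zero_of_tendsto_natCast_mul h)
  rw [mul_zero] at h1
  exact h1.congr fun n => by ring

section FirstOrder

variable {m : ℝ → ℝ} {L K r₀ : ℝ} {x : ℕ → ℝ}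

lemma tendsto_natCast_mul_of_radius (hr₀ : 0 < r₀)
    (hm : ∀ r, 0 ≤ r → r ≤ r₀ → |m r - L * r| ≤ K * r ^ 2) (hx : ∀ n, 0 ≤ x n) {ρ : ℝ}
    (h : Tendsto (fun n : ℕ => (n : ℝ) * x n) atTop (𝓝 ρ)) :
    Tendsto (fun n : ℕ => (n : ℝ) * m (x n)) atTop (𝓝 (L * ρ)) := by
  have h0 : Tendsto (fun n : ℕ => (n : ℝ) * m (x n) - L * (n * x n)) atTop (𝓝 0) := by
    refine squeeze_zero_norm' ?_ (by simpa using (tendsto_natCast_mul_sq h).const_mul K)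
    filter_upwards [(tendsto_zero_of_tendsto_natCast_mul h).eventually_le_const hr₀] with n hn
    rw [show (n : ℝ) * m (x n) - L * (n * x n) = n * (m (x n) - L * x n) by ring, norm_mul,
      Real.norm_of_nonneg (Nat.cast_nonneg n), Real.norm_eq_abs]
    have := mul_le_mul_of_nonneg_left (hm _ (hx n) hn) (Nat.cast_nonneg (α := ℝ) n)
    linarith
  simpa using h0.add (h.const_mul L)

/-- The linear approximation holds only for small radii. Monotonicity of the measure shows that
small measure forces a small radius, after which the approximation can be inverted. -/
lemma tendsto_radius_of_natCast_mul (hr₀ : 0 < r₀) (hL : 0 < L) (hK : 0 < K)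
    (hm : ∀ r, 0 ≤ r → r ≤ r₀ → |m r - L * r| ≤ K * r ^ 2)
    (hmono : ∀ r s, 0 ≤ r → r ≤ s → m r ≤ m s) (hx : ∀ n, 0 ≤ x n) {τ : ℝ}
    (h : Tendsto (fun n : ℕ => (n : ℝ) * m (x n)) atTop (𝓝 τ)) :
    Tendsto (fun n : ℕ => (n : ℝ) * x n) atTop (𝓝 (τ / L)) := by
  have hm0 := tendsto_zero_of_tendsto_natCast_mul h
  set δ := min r₀ (L / (2 * K)) with hδ
  have hδ0 : 0 < δ := by positivity
  have hlow {r : ℝ} (h0 : 0 ≤ r) (h1 : r ≤ δ) : L / 2 * r ≤ m r := by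
    have e1 := (abs_le.1 (hm r h0 (h1.trans (min_le_left _ _)))).1
    have e2 : r ≤ L / (2 * K) := h1.trans (min_le_right _ _)
    rw [le_div_iff₀ (by positivity)] at e2
    nlinarith
  have hsmall {s : ℝ} (hs0 : 0 < s) (hs : s ≤ δ) : ∀ᶠ n in atTop, x n < s := by
    filter_upwards [hm0.eventually_lt_const (show 0 < L / 2 * s by positivity)] with n hn
    by_contra hge
    exact absurd ((hlow hs0.le hs).trans (hmono _ _ hs0.le (not_lt.1 hge))) (not_le.2 hn)
  have hx0 : Tendsto x atTop (𝓝 0) := by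
    rw [tendsto_order]
    refine ⟨fun a ha => .of_forall fun n => ha.trans_le (hx n), fun a ha => ?_⟩
    filter_upwards [hsmall (lt_min ha hδ0) (min_le_right a δ)] with n hn
    exact hn.trans_le (min_le_left _ _)
  have h0 : Tendsto (fun n : ℕ => L * ((n : ℝ) * x n) - n * m (x n)) atTop (𝓝 0) := by
    have hb : Tendsto (fun n : ℕ => 2 * K / L * ((n : ℝ) * m (x n)) * x n) atTop (𝓝 0) := by
      simpa using (h.const_mul (2 * K / L)).mul hx0
    refine squeeze_zero_norm' ?_ hb
    filter_upwards [hsmall hδ0 le_rfl] with n hn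
    have e1 := hm _ (hx n) (hn.le.trans (min_le_left _ _))
    have e2 := hlow (hx n) hn.le
    have hn0 : (0 : ℝ) ≤ n := Nat.cast_nonneg n
    rw [show L * ((n : ℝ) * x n) - n * m (x n) = -(n * (m (x n) - L * x n)) by ring, norm_neg,
      norm_mul, Real.norm_of_nonneg hn0, Real.norm_eq_abs]
    have e3 : x n ≤ 2 / L * m (x n) := by
      rw [div_mul_eq_mul_div, le_div_iff₀ hL]; linarith
    calc (n : ℝ) * |m (x n) - L * x n| ≤ n * (K * x n ^ 2) := by gcongr
      _ = n * K * x n * x n := by ring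
      _ ≤ n * K * (2 / L * m (x n)) * x n := by have := hx n; gcongr
      _ = _ := by ring
  have h1 := (h0.add h).div_const L
  rw [zero_add] at h1
  refine h1.congr fun n => ?_
  field_simp; ring

end FirstOrder

/-- Twice the length of the `i`-th segment. -/
def segWeight (ε : ℝ) : Fin 2 → ℝ := ![4 * ε, 2 * (lam ^ 2 - lam) * ε]

lemma segWeight_pos {ε : ℝ} (hε : 0 < ε) (i : Fin 2) : 0 < segWeight ε i := by
  have h : 0 < lam ^ 2 - lam := by nlinarith [two_lt_lam]
  fin_cases i
  · simpa [segWeight] using hε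
  · simp only [segWeight, Fin.mk_one, Matrix.cons_val_one, Matrix.cons_val_fin_one]; positivity

lemma segNhd_zero (ε : ℝ) (i : Fin 2) : segNhd ε i 0 = ∅ := by
  rw [segNhd, Set.image_eq_empty, Set.eq_empty_iff_forall_notMem]
  rintro w ⟨s, -, hs⟩
  nlinarith [sq_nonneg (w.1 - s), sq_nonneg w.2]

lemma clusterSet_zero (U : Set Torus) : clusterSet U 0 = U := by simp [clusterSet]

/-- Radii below this are small enough for the covering to be injective on `planeNhd`. -/
def safeRadius (ε : ℝ) : ℝ := min 1 (latticeGap / (4 * reach ε))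

lemma safeRadius_pos {ε : ℝ} (hε : 0 < ε) : 0 < safeRadius ε := by
  have := reach_pos hε
  have := latticeGap_pos
  unfold safeRadius; positivity

lemma abs_measureReal_segNhd_sub_le {ε : ℝ} (hε : 0 < ε) (i : Fin 2) (r : ℝ) (hr : 0 ≤ r)
    (hr' : r ≤ safeRadius ε) :
    |(volume : Measure Torus).real (segNhd ε i r) - segWeight ε i * r| ≤ 16 * r ^ 2 := by
  have hR := reach_pos hε
  have h1 : r ≤ 1 := hr'.trans (min_le_left _ _)
  have h2 : 4 * lam ^ 0 * reach ε * r ≤ latticeGap := by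
    have := hr'.trans (min_le_right _ _)
    rw [le_div_iff₀ (by positivity)] at this
    rw [pow_zero]; linarith
  fin_cases i
  · have := abs_measureReal_clusterSet_sub_le hε hr le_rfl le_rfl hr h1 h2
    rw [clusterSet_zero, torusNhd_eq, segNhd_zero, Set.union_empty, clusterArea, if_pos rfl] at this
    simpa [segWeight] using this
  · have := abs_measureReal_clusterSet_sub_le hε le_rfl hr hr le_rfl h1 h2
    rw [clusterSet_zero, torusNhd_eq, segNhd_zero, Set.empty_union, clusterArea, if_pos rfl] at this
    simpa [segWeight] using this

lemma measureReal_segNhd_mono (ε : ℝ) (i : Fin 2) (r s : ℝ) (hr : 0 ≤ r) (hrs : r ≤ s) :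
    (volume : Measure Torus).real (segNhd ε i r) ≤ (volume : Measure Torus).real (segNhd ε i s) :=
  measureReal_mono (Set.image_mono (stadium_mono _ _ hr hrs)) (measure_ne_top _ _)

theorem exists_isNormalising {ε : ℝ} (hε : 0 < ε) {g : Fin 2 → ℝ → EReal}
    (hg : ∀ i, IsShape (g i)) {τ : Fin 2 → ℝ} (hτ : ∀ i, 0 ≤ τ i) :
    ∃ u : ℕ → Fin 2 → ℝ, IsNormalising volume (observable ε g) τ u := by
  set x : ℕ → Fin 2 → ℝ := fun n i =>
    -- The added `1 / (n + 1)` keeps the radius positive when `τ i = 0`, as needed to realise it by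
    -- a level, and vanishes in the limit.
    (τ i + 1 / ((n : ℝ) + 1)) / segWeight ε i * (1 / ((n : ℝ) + 1)) with hx
  have hpos (n : ℕ) (i : Fin 2) : 0 < x n i := by
    have := segWeight_pos hε i
    have := hτ i
    simp only [hx]; positivity
  choose u hu using fun (n : ℕ) (i : Fin 2) => (hg i).exists_level (hpos n i)
  refine ⟨u, fun i => ?_⟩
  have h1 := tendsto_one_div_add_atTop_nhds_zero_nat (𝕜 := ℝ)
  have h2 : Tendsto (fun n : ℕ => (n : ℝ) * x n i) atTop (𝓝 (τ i / segWeight ε i)) := by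
    have h3 := ((h1.const_add (τ i)).div_const (segWeight ε i)).mul
      (tendsto_natCast_div_add_atTop (𝕜 := ℝ) 1)
    rw [add_zero, mul_one] at h3
    refine h3.congr fun n => ?_
    simp only [hx]; ring
  have h3 := tendsto_natCast_mul_of_radius (safeRadius_pos hε)
    (abs_measureReal_segNhd_sub_le hε i) (fun n => (hpos n i).le) h2
  rw [mul_div_cancel₀ _ (segWeight_pos hε i).ne'] at h3
  refine h3.congr fun n => ?_
  rw [setOf_lt_observable hε (hpos n i).le fun t ht _ => hu n i t ht]

theorem exists_radii {ε : ℝ} (hε : 0 < ε) {g : Fin 2 → ℝ → EReal} (hg : ∀ i, IsShape (g i))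
    {τ : Fin 2 → ℝ} {u : ℕ → Fin 2 → ℝ} (hu : IsNormalising volume (observable ε g) τ u) :
    ∃ x : ℕ → Fin 2 → ℝ, (∀ n i, 0 ≤ x n i) ∧
      (∀ n, exceed catMap (observable ε g) (u n) = torusNhd ε (x n 0) (x n 1)) ∧
      ∀ i, Tendsto (fun n : ℕ => (n : ℝ) * x n i) atTop (𝓝 (τ i / segWeight ε i)) := by
  choose x hx0 hx using fun (n : ℕ) (i : Fin 2) => (hg i).exists_radius (u n i)
  have hset (n : ℕ) (i : Fin 2) := setOf_lt_observable hε (g := g) (hx0 n i) (hx n i)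
  refine ⟨x, hx0, fun n => ?_, fun i => ?_⟩
  · rw [exceed_eq, hset, hset, torusNhd_eq]
  · refine tendsto_radius_of_natCast_mul (safeRadius_pos hε) (segWeight_pos hε i)
      (show (0 : ℝ) < 16 by norm_num) (abs_measureReal_segNhd_sub_le hε i)
      (measureReal_segNhd_mono ε i) (fun n => hx0 n i) ?_
    refine (hu i).congr fun n => ?_
    rw [hset]

/-! ### Gaps and blocks -/

/-- The gap sequence in the mixing condition. -/
def gapLength (n : ℕ) : ℕ := 2 * (Nat.sqrt n + 1)

/-- The number of blocks in the separation condition. -/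
def blockCount (n : ℕ) : ℕ := Nat.sqrt (Nat.sqrt n)

lemma tendsto_natSqrt : Tendsto Nat.sqrt atTop atTop :=
  tendsto_atTop_atTop.2 fun b => ⟨b * b, fun _ h => Nat.le_sqrt.2 h⟩

lemma tendsto_blockCount : Tendsto blockCount atTop atTop := tendsto_natSqrt.comp tendsto_natSqrt

/-- Gaps are of order `n^(1/2)` and the blocks number about `n^(1/4)`. Concretely, the square of the
block count times the gap is at most `4 * n`. -/
lemma tendsto_blockCount_mul_gapLength :
    Tendsto (fun n : ℕ => (blockCount n : ℝ) * (gapLength n : ℝ) / (n : ℝ)) atTop (𝓝 0) := by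
  have h1 : Tendsto (fun n : ℕ => 4 * ((blockCount n : ℝ))⁻¹) atTop (𝓝 0) := by
    simpa using (tendsto_inv_atTop_zero.comp
      ((tendsto_natCast_atTop_atTop (R := ℝ)).comp tendsto_blockCount)).const_mul 4
  refine squeeze_zero' (.of_forall fun n => by positivity) ?_ h1
  filter_upwards [eventually_ge_atTop 1] with n hn
  have hb : 1 ≤ Nat.sqrt n := Nat.le_sqrt.2 (by simpa using hn)
  have hk : 1 ≤ blockCount n := Nat.le_sqrt.2 (by simpa using hb)
  have hkb : blockCount n * blockCount n ≤ Nat.sqrt n := Nat.sqrt_le _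
  have hbn : Nat.sqrt n * Nat.sqrt n ≤ n := Nat.sqrt_le _
  have hn0 : (0 : ℝ) < n := by positivity
  have hk0 : (0 : ℝ) < blockCount n := by positivity
  rw [div_le_iff₀ hn0, mul_assoc, inv_mul_eq_div, mul_div_assoc', le_div_iff₀ hk0]
  have : blockCount n * gapLength n * blockCount n ≤ 4 * n := by
    unfold gapLength
    calc blockCount n * (2 * (Nat.sqrt n + 1)) * blockCount n
        = (blockCount n * blockCount n) * (2 * (Nat.sqrt n + 1)) := by ring
      _ ≤ Nat.sqrt n * (2 * (Nat.sqrt n + Nat.sqrt n)) := by gcongr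
      _ = 4 * (Nat.sqrt n * Nat.sqrt n) := by ring
      _ ≤ 4 * n := by gcongr
  exact_mod_cast this

lemma tendsto_gapLength_div :
    Tendsto (fun n : ℕ => (gapLength n : ℝ) / (n : ℝ)) atTop (𝓝 0) := by
  refine squeeze_zero' (.of_forall fun n => by positivity) ?_ tendsto_blockCount_mul_gapLength
  filter_upwards [tendsto_blockCount.eventually_ge_atTop 1] with n hn
  gcongr
  have : (1 : ℝ) ≤ blockCount n := by exact_mod_cast hn
  exact le_mul_of_one_le_left (Nat.cast_nonneg _) this

lemma tendsto_natCast_mul_lam_gapLength :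
    Tendsto (fun n : ℕ => (n : ℝ) * (lam ^ (gapLength n / 2))⁻¹) atTop (𝓝 0) := by
  have hl : lam⁻¹ < 1 := inv_lt_one_of_one_lt₀ (by linarith [two_lt_lam])
  have h1 := (tendsto_pow_const_mul_const_pow_of_lt_one 2 (inv_pos.2 lam_pos).le hl).comp
    ((tendsto_add_atTop_nat 1).comp tendsto_natSqrt)
  refine squeeze_zero (fun n => by have := lam_pos; positivity) (fun n => ?_) h1
  have h2 : gapLength n / 2 = Nat.sqrt n + 1 := by unfold gapLength; omega
  simp only [Function.comp, h2, inv_pow]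
  have h3 : n ≤ (Nat.sqrt n + 1) ^ 2 := by
    rw [pow_two]; exact (Nat.lt_succ_sqrt n).le
  have := lam_pos
  gcongr
  exact_mod_cast h3

/-! ### The limit theorems along a sequence of radii -/

section Sequence

variable {ε : ℝ} {x : ℕ → Fin 2 → ℝ} {ρ : Fin 2 → ℝ}

/-- A positive upper bound for the two radii. -/
def radiusBound (x : ℕ → Fin 2 → ℝ) (n : ℕ) : ℝ := max (x n 0) (x n 1) + 1 / ((n : ℝ) + 1)

lemma le_radiusBound (x : ℕ → Fin 2 → ℝ) (n : ℕ) (i : Fin 2) : x n i ≤ radiusBound x n := by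
  have h : (0 : ℝ) < 1 / ((n : ℝ) + 1) := by positivity
  unfold radiusBound
  fin_cases i
  · exact (le_max_left (x n 0) (x n 1)).trans (by linarith)
  · exact (le_max_right (x n 0) (x n 1)).trans (by linarith)

lemma radiusBound_pos (hx0 : ∀ n i, 0 ≤ x n i) (n : ℕ) : 0 < radiusBound x n :=
  add_pos_of_nonneg_of_pos ((hx0 n 0).trans (le_max_left _ _)) (by positivity)

lemma tendsto_natCast_mul_radiusBound
    (hx : ∀ i, Tendsto (fun n : ℕ => (n : ℝ) * x n i) atTop (𝓝 (ρ i))) :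
    Tendsto (fun n : ℕ => (n : ℝ) * radiusBound x n) atTop (𝓝 (max (ρ 0) (ρ 1) + 1)) := by
  refine (((hx 0).max (hx 1)).add (tendsto_natCast_div_add_atTop (𝕜 := ℝ) 1)).congr fun n => ?_
  rw [radiusBound, mul_add, mul_max_of_nonneg _ _ (Nat.cast_nonneg n), mul_one_div]

lemma eventually_radiusBound_le
    (hx : ∀ i, Tendsto (fun n : ℕ => (n : ℝ) * x n i) atTop (𝓝 (ρ i))) {c : ℝ} (hc : 0 < c) :
    ∀ᶠ n in atTop, radiusBound x n ≤ c :=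
  (tendsto_zero_of_tendsto_natCast_mul (tendsto_natCast_mul_radiusBound hx)).eventually_le_const hc

/-- Positive homogeneity turns the limit of `n` times an area into continuity at the limiting
rescaled radii. -/
lemma natCast_mul_clusterArea (ε : ℝ) (q n : ℕ) (r₁ r₂ : ℝ) :
    (n : ℝ) * clusterArea ε q r₁ r₂ = clusterArea ε q (n * r₁) (n * r₂) := by
  have h (a b : ℝ) : (n : ℝ) * max (a - b) 0 = max (n * a - n * b) 0 := by
    rw [mul_max_of_nonneg _ _ (Nat.cast_nonneg n), mul_sub, mul_zero]
  unfold clusterArea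
  split_ifs
  · ring
  · have := h r₁ 0
    rw [mul_zero] at this
    rw [← this]; ring
  · have := h r₁ (lam ^ 2 * r₂)
    rw [mul_left_comm] at this
    rw [← this]; ring

lemma continuous_clusterArea (ε : ℝ) (q : ℕ) :
    Continuous (fun p : ℝ × ℝ => clusterArea ε q p.1 p.2) := by
  unfold clusterArea
  split_ifs <;> fun_prop

theorem tendsto_measureReal_clusterSet (hε : 0 < ε) (hx0 : ∀ n i, 0 ≤ x n i)
    (hx : ∀ i, Tendsto (fun n : ℕ => (n : ℝ) * x n i) atTop (𝓝 (ρ i))) (q : ℕ) :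
    Tendsto (fun n : ℕ => (n : ℝ) *
      (volume : Measure Torus).real (clusterSet (torusNhd ε (x n 0) (x n 1)) q)) atTop
      (𝓝 (clusterArea ε q (ρ 0) (ρ 1))) := by
  have hR := tendsto_natCast_mul_radiusBound hx
  have hr := reach_pos hε
  have hl := lam_pos
  have h0 : Tendsto (fun n : ℕ => (n : ℝ) *
      (volume : Measure Torus).real (clusterSet (torusNhd ε (x n 0) (x n 1)) q) -
      n * clusterArea ε q (x n 0) (x n 1)) atTop (𝓝 0) := by
    refine squeeze_zero_norm' ?_
      (by simpa using (tendsto_natCast_mul_sq hR).const_mul (16 * (q + 1) : ℝ))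
    filter_upwards [eventually_radiusBound_le hx one_pos, eventually_radiusBound_le hx
      (show 0 < latticeGap / (4 * lam ^ q * reach ε) from
        div_pos latticeGap_pos (by positivity))] with n h1 h2
    rw [le_div_iff₀ (by positivity), mul_comm] at h2
    have h3 := abs_measureReal_clusterSet_sub_le hε (hx0 n 0) (hx0 n 1) (le_radiusBound x n 0)
      (le_radiusBound x n 1) h1 h2
    rw [← mul_sub, norm_mul, Real.norm_of_nonneg (Nat.cast_nonneg n), Real.norm_eq_abs]
    have := mul_le_mul_of_nonneg_left h3 (Nat.cast_nonneg (α := ℝ) n)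
    linarith
  have h1 : Tendsto (fun n : ℕ => (n : ℝ) * clusterArea ε q (x n 0) (x n 1)) atTop
      (𝓝 (clusterArea ε q (ρ 0) (ρ 1))) := by
    simp only [natCast_mul_clusterArea]
    exact ((continuous_clusterArea ε q).tendsto (ρ 0, ρ 1)).comp ((hx 0).prodMk_nhds (hx 1))
  simpa using h0.add h1

lemma eventually_pair_le (hε : 0 < ε) (hx0 : ∀ n i, 0 ≤ x n i)
    (hx : ∀ i, Tendsto (fun n : ℕ => (n : ℝ) * x n i) atTop (𝓝 (ρ i))) {q : ℕ} (hq : 3 ≤ q) :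
    ∀ᶠ n in atTop, ∀ j, 1 ≤ j → (volume : Measure Torus).real
      (clusterSet (torusNhd ε (x n 0) (x n 1)) q ∩
        catMap^[j] ⁻¹' clusterSet (torusNhd ε (x n 0) (x n 1)) q) ≤
      pairBound ε * radiusBound x n ^ 2 := by
  filter_upwards [eventually_radiusBound_le hx one_pos, eventually_radiusBound_le hx hε]
    with n h1 h2 j hj
  exact measureReal_clusterSet_inter_preimage_le hε (hx0 n 0) (hx0 n 1) (le_radiusBound x n 0)
    (le_radiusBound x n 1) (radiusBound_pos hx0 n) h2 h1 hq hj

lemma mixing_clusterSet (hε : 0 < ε) (hx0 : ∀ n i, 0 ≤ x n i) {n : ℕ}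
    (h1 : radiusBound x n ≤ 1) (q : ℕ) (s : Finset ℕ) (t : ℕ) :
    |(volume : Measure Torus).real (clusterSet (torusNhd ε (x n 0) (x n 1)) q ∩ catMap^[t] ⁻¹'
        ⋂ i ∈ s, catMap^[i] ⁻¹' (clusterSet (torusNhd ε (x n 0) (x n 1)) q)ᶜ)
      - (volume : Measure Torus).real (clusterSet (torusNhd ε (x n 0) (x n 1)) q) *
        (volume : Measure Torus).real
          (⋂ i ∈ s, catMap^[i] ⁻¹' (clusterSet (torusNhd ε (x n 0) (x n 1)) q)ᶜ)| ≤
      6 * perimeterBound ε q * (lam ^ (t / 2))⁻¹ := by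
  have h := shiftDefect_clusterSet_le hε (hx0 n 0) (hx0 n 1) ((le_radiusBound x n 0).trans h1)
    ((le_radiusBound x n 1).trans h1) q
  exact abs_measureReal_inter_preimage_sub_le
    (measurableSet_clusterSet (measurableSet_torusNhd _ _ _) q) (fun v => (h v).1)
    (fun v => (h v).2) s t

/-- The fixed value `q = 3` suffices: the pair bound is available and the first-order area is
already stationary. -/
theorem tendsto_measureReal_avoid (hε : 0 < ε) (hx0 : ∀ n i, 0 ≤ x n i)
    (hx : ∀ i, Tendsto (fun n : ℕ => (n : ℝ) * x n i) atTop (𝓝 (ρ i))) :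
    Tendsto (fun n : ℕ => (volume : Measure Torus).real
      (⋂ i ∈ Finset.range n, catMap^[i] ⁻¹' (torusNhd ε (x n 0) (x n 1))ᶜ)) atTop
      (𝓝 (Real.exp (-clusterArea ε 3 (ρ 0) (ρ 1)))) := by
  set U : ℕ → Set Torus := fun n => torusNhd ε (x n 0) (x n 1) with hU
  have hUm (n : ℕ) : MeasurableSet (U n) := measurableSet_torusNhd _ _ _
  have hR := tendsto_natCast_mul_radiusBound hx
  have hpow : Tendsto (fun n : ℕ => (1 - (volume : Measure Torus).real (clusterSet (U n) 3)) ^ n)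
      atTop (𝓝 (Real.exp (-clusterArea ε 3 (ρ 0) (ρ 1)))) := by
    have h := (tendsto_measureReal_clusterSet hε hx0 hx 3).neg
    simp only [← mul_neg] at h
    exact Real.tendsto_one_add_pow_exp_of_tendsto h
  have h1 : Tendsto (fun n : ℕ => (volume : Measure Torus).real
      (⋂ i ∈ Finset.range n, catMap^[i] ⁻¹' (clusterSet (U n) 3)ᶜ) -
      (1 - (volume : Measure Torus).real (clusterSet (U n) 3)) ^ n) atTop (𝓝 0) := by
    -- The error `n * (2 * t * η + γ)` with `η = O(r²)`: since `n * r` converges, the first part is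
    -- of the order of `t / n`.
    have hb : Tendsto (fun n : ℕ => 2 * pairBound ε *
        (((n : ℝ) * radiusBound x n) * (n * radiusBound x n) * (gapLength n / n)) +
        6 * perimeterBound ε 3 * (n * (lam ^ (gapLength n / 2))⁻¹)) atTop (𝓝 0) := by
      simpa using (((hR.mul hR).mul tendsto_gapLength_div).const_mul (2 * pairBound ε)).add
        (tendsto_natCast_mul_lam_gapLength.const_mul (6 * perimeterBound ε 3))
    refine squeeze_zero_norm' ?_ hb
    filter_upwards [eventually_pair_le hε hx0 hx le_rfl, eventually_radiusBound_le hx one_pos,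
      eventually_ge_atTop 1] with n hpair hr1 hn
    have hn0 : (n : ℝ) ≠ 0 := by positivity
    have := abs_measureReal_sub_pow_le (measurableSet_clusterSet (hUm n) 3)
      (t := gapLength n) (by unfold gapLength; omega) hpair
      (fun m => mixing_clusterSet hε hx0 hr1 3 (Finset.range m) (gapLength n)) n
    rw [Real.norm_eq_abs]
    refine this.trans (le_of_eq ?_)
    field_simp
  have h2 : Tendsto (fun n : ℕ => (volume : Measure Torus).real
      (⋂ i ∈ Finset.range n, catMap^[i] ⁻¹' (U n)ᶜ) - (volume : Measure Torus).real
      (⋂ i ∈ Finset.range n, catMap^[i] ⁻¹' (clusterSet (U n) 3)ᶜ)) atTop (𝓝 0) := by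
    have hb := (tendsto_zero_of_tendsto_natCast_mul
      (tendsto_measureReal_clusterSet hε hx0 hx 0)).const_mul (3 : ℝ)
    simp only [clusterSet_zero, mul_zero] at hb
    refine squeeze_zero_norm (fun n => ?_) hb
    exact_mod_cast abs_measureReal_avoid_sub_clusterSet_le (hUm n) 3 n
  simpa using (h2.add h1).add hpow

end Sequence

/-! ### The dependence conditions and the value of the extremal index -/

lemma tendsto_ofReal_mul {a b : ℕ → ℝ} (h : Tendsto (fun n => a n * b n) atTop (𝓝 0)) :
    Tendsto (fun n => ENNReal.ofReal (a n * b n)) atTop (𝓝 0) := by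
  simpa using ENNReal.tendsto_ofReal h

section Conditions

variable {ε : ℝ} {Ψ : Torus → Fin 2 → EReal} {u : ℕ → Fin 2 → ℝ} {x : ℕ → Fin 2 → ℝ}
  {ρ : Fin 2 → ℝ}

theorem mixingCondition (hε : 0 < ε) (hx0 : ∀ n i, 0 ≤ x n i)
    (hx : ∀ i, Tendsto (fun n : ℕ => (n : ℝ) * x n i) atTop (𝓝 (ρ i)))
    (hU : ∀ n, exceed catMap Ψ (u n) = torusNhd ε (x n 0) (x n 1)) :
    MixingCondition volume catMap Ψ u fun _ => gapLength := by
  classical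
  set b : ℕ → ℕ → ℝ := fun q s => 6 * perimeterBound ε q * (lam ^ (s / 2))⁻¹ with hb
  have hP (q : ℕ) : 0 ≤ perimeterBound ε q := by
    have := reach_pos hε
    have := lam_pos
    unfold perimeterBound; positivity
  have hb0 (q s : ℕ) : 0 ≤ b q s := by
    have := lam_pos
    have := hP q
    positivity
  -- The perimeter bound requires radii at most 1. For the remaining finitely many `n` the trivial
  -- bound 1 serves, both terms being in `[0, 1]`.
  refine ⟨fun q n s => if radiusBound x n ≤ 1 then (b q s).toNNReal else 1, fun q n s s' h => ?_,
    fun q n s ℓ _ _ _ => ?_, fun q n => by dsimp only [gapLength]; omega, fun q => tendsto_gapLength_div,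
    ?_⟩
  · dsimp only
    split_ifs
    · refine Real.toNNReal_mono ?_
      have := hP q
      have := lam_pos
      simp only [hb]
      gcongr
      linarith [two_lt_lam]
    · exact le_rfl
  · rw [clusterEnd_eq, hU, avoid_eq, avoid_eq]
    dsimp only
    split_ifs with h1
    · rw [Real.coe_toNNReal _ (hb0 q s)]
      exact mixing_clusterSet hε hx0 h1 q _ s
    · rw [NNReal.coe_one]
      refine abs_sub_le_of_nonneg_of_le measureReal_nonneg measureReal_le_one
        (mul_nonneg measureReal_nonneg measureReal_nonneg)
        (mul_le_one₀ measureReal_le_one measureReal_nonneg measureReal_le_one)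
  -- The upper limit in `n` already vanishes for each `q`.
  · refine tendsto_const_nhds.congr fun q => ?_
    symm
    refine Tendsto.limsup_eq ?_
    have h1 : Tendsto (fun n : ℕ => ENNReal.ofReal ((n : ℝ) * b q (gapLength n))) atTop (𝓝 0) := by
      refine tendsto_ofReal_mul ?_
      have := tendsto_natCast_mul_lam_gapLength.const_mul (6 * perimeterBound ε q)
      rw [mul_zero] at this
      exact this.congr fun n => by simp only [hb]; ring
    refine h1.congr' ?_
    filter_upwards [eventually_radiusBound_le hx one_pos] with n hn
    rw [if_pos hn, ENNReal.ofReal_mul (Nat.cast_nonneg n), ENNReal.ofReal_natCast]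
    rfl

/-- For `q ≥ 3` there are at most `n / k n` terms of size `O(r²)`; with `n * r` bounded, the total
is of the order of `1 / k n`. -/
theorem separationCondition (hε : 0 < ε) (hx0 : ∀ n i, 0 ≤ x n i)
    (hx : ∀ i, Tendsto (fun n : ℕ => (n : ℝ) * x n i) atTop (𝓝 (ρ i)))
    (hU : ∀ n, exceed catMap Ψ (u n) = torusNhd ε (x n 0) (x n 1)) :
    SeparationCondition volume catMap Ψ u fun _ => gapLength := by
  refine ⟨blockCount, tendsto_blockCount, fun q => tendsto_blockCount_mul_gapLength, ?_⟩
  refine tendsto_const_nhds.congr' ?_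
  filter_upwards [eventually_ge_atTop 3] with q hq
  symm
  refine Tendsto.limsup_eq ?_
  have hR := tendsto_natCast_mul_radiusBound hx
  have hb : Tendsto (fun n : ℕ => ENNReal.ofReal (pairBound ε *
      (((n : ℝ) * radiusBound x n) * (n * radiusBound x n) * (blockCount n : ℝ)⁻¹)))
      atTop (𝓝 0) := by
    refine tendsto_ofReal_mul ?_
    simpa using ((hR.mul hR).mul (tendsto_inv_atTop_zero.comp
      ((tendsto_natCast_atTop_atTop (R := ℝ)).comp tendsto_blockCount))).const_mul (pairBound ε)
  refine tendsto_of_tendsto_of_tendsto_of_le_of_le' tendsto_const_nhds hb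
    (.of_forall fun n => zero_le) ?_
  filter_upwards [eventually_pair_le hε hx0 hx hq] with n hpair
  have hPB := pairBound_pos hε
  have hterm (j : ℕ) (hj : j ∈ Finset.Ico (q + 1) (n / blockCount n)) :
      volume (clusterEnd catMap Ψ q (u n) ∩ catMap^[j] ⁻¹' clusterEnd catMap Ψ q (u n)) ≤
        ENNReal.ofReal (pairBound ε * radiusBound x n ^ 2) := by
    rw [clusterEnd_eq, hU, ← ENNReal.ofReal_toReal (measure_ne_top volume _)]
    exact ENNReal.ofReal_le_ofReal (hpair j (by have := (Finset.mem_Ico.1 hj).1; omega))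
  refine (mul_le_mul_right (Finset.sum_le_card_nsmul _ _ _ hterm) _).trans ?_
  rw [nsmul_eq_mul, ← ENNReal.ofReal_natCast n, ← ENNReal.ofReal_natCast (Finset.card _),
    ← ENNReal.ofReal_mul (Nat.cast_nonneg _), ← ENNReal.ofReal_mul (Nat.cast_nonneg _)]
  refine ENNReal.ofReal_le_ofReal ?_
  have hcard : ((Finset.Ico (q + 1) (n / blockCount n)).card : ℝ) ≤ n * (blockCount n : ℝ)⁻¹ := by
    rw [Nat.card_Ico, ← div_eq_mul_inv]
    exact (Nat.cast_le.2 (Nat.sub_le _ _)).trans Nat.cast_div_le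
  calc (n : ℝ) * (((Finset.Ico (q + 1) (n / blockCount n)).card : ℝ) *
        (pairBound ε * radiusBound x n ^ 2))
      ≤ n * ((n * (blockCount n : ℝ)⁻¹) * (pairBound ε * radiusBound x n ^ 2)) := by gcongr
    _ = _ := by ring

end Conditions

lemma clusterArea_eq_theta {ε : ℝ} (hε : 0 < ε) {τ : Fin 2 → ℝ} (hΓ : 0 < τ 0 + τ 1) {q : ℕ}
    (hq : 2 ≤ q) :
    clusterArea ε q (τ 0 / segWeight ε 0) (τ 1 / segWeight ε 1) = theta τ * gammaHat τ := by
  have hl := two_lt_lam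
  have hl0 := lam_pos
  have h21 : 0 < lam - 1 := by linarith
  have hw0 : segWeight ε 0 = 4 * ε := rfl
  have hw1 : segWeight ε 1 = 2 * (lam * (lam - 1)) * ε := by
    change 2 * (lam ^ 2 - lam) * ε = _; ring
  have e0 : 2 * ε * (1 - lam⁻¹) * (τ 0 / segWeight ε 0) = (lam - 1) * τ 0 / (2 * lam) := by
    rw [hw0]; field_simp; ring
  have e1 : 2 * ε * (1 - lam⁻¹) * (lam ^ 2 * (τ 1 / segWeight ε 1)) = τ 1 := by
    rw [hw1]; field_simp
  have e2 : 2 * (lam ^ 2 - lam) * ε * (τ 1 / segWeight ε 1) = τ 1 := by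
    rw [hw1]; field_simp
  have hc : 0 < 2 * ε * (1 - lam⁻¹) := by
    have : lam⁻¹ < 1 := inv_lt_one_of_one_lt₀ (by linarith)
    have : 0 < 1 - lam⁻¹ := by linarith
    positivity
  rw [clusterArea, if_neg (by omega), if_neg (by omega), mul_add _ (τ 0 / _),
    mul_max_of_nonneg _ _ hc.le, mul_sub _ (τ 0 / _), e0, e1, e2, mul_zero, theta, gammaHat]
  -- The threshold for `α` is where `r₁ = lam² r₂`, that is, where the second strip just catches all
  -- of the right slab.
  have hiff : τ 0 / (τ 0 + τ 1) ≤ 2 * lam / (3 * lam - 1) ↔ (lam - 1) * τ 0 / (2 * lam) ≤ τ 1 := by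
    rw [div_le_div_iff₀ hΓ (by linarith), div_le_iff₀ (by positivity)]
    constructor <;> intro h <;> linarith
  split_ifs with h
  · rw [max_eq_right (sub_nonpos.2 (hiff.1 h))]
    field_simp; ring
  · rw [max_eq_left (sub_nonneg.2 (not_le.1 (fun h' => h (hiff.2 h'))).le)]
    field_simp; ring

lemma clusterArea_zero_eq {ε : ℝ} (hε : 0 < ε) (τ : Fin 2 → ℝ) :
    clusterArea ε 0 (τ 0 / segWeight ε 0) (τ 1 / segWeight ε 1) = gammaHat τ := by
  have h0 := (segWeight_pos hε 0).ne'
  have h1 := (segWeight_pos hε 1).ne'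
  have e : clusterArea ε 0 (τ 0 / segWeight ε 0) (τ 1 / segWeight ε 1) =
    segWeight ε 0 * (τ 0 / segWeight ε 0) + segWeight ε 1 * (τ 1 / segWeight ε 1) := rfl
  rw [e, mul_div_cancel₀ _ h0, mul_div_cancel₀ _ h1, gammaHat]

end

end MultivariateExtremes

/-! ### The extreme value law for the cat map -/

theorem mainTheorem3 (ε : ℝ) (hε : 0 < ε) (g : Fin 2 → ℝ → EReal) (hg : ∀ i, IsShape (g i)) :
    IsProbabilityMeasure (volume : Measure Torus) ∧
    MeasurePreserving catMap (volume : Measure Torus) (volume : Measure Torus) ∧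
    Measurable (observable ε g) ∧
    ∀ τ : Fin 2 → ℝ, (∀ i, 0 ≤ τ i) → τ ≠ 0 →
      (∃ u : ℕ → Fin 2 → ℝ, IsNormalising volume (observable ε g) τ u) ∧
      ∀ u : ℕ → Fin 2 → ℝ, IsNormalising volume (observable ε g) τ u →
        HasTailLimit volume catMap (observable ε g) u (gammaHat τ) ∧
        (∃ t : ℕ → ℕ → ℕ,
          MixingCondition volume catMap (observable ε g) u t ∧
          SeparationCondition volume catMap (observable ε g) u t) ∧
        HasExtremalIndex volume catMap (observable ε g) u (theta τ) ∧
        Tendsto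
          (fun n : ℕ => (volume : Measure Torus).real (maxLE catMap (observable ε g) n (u n)))
          atTop (𝓝 (Real.exp (-(theta τ * gammaHat τ)))) := by
  refine ⟨inferInstance, measurePreserving_catMap, measurable_observable hε hg,
    fun τ hτ hτ0 => ⟨exists_isNormalising hε hg hτ, fun u hu => ?_⟩⟩
  obtain ⟨x, hx0, hU, hx⟩ := exists_radii hε hg hu
  have hΓ : 0 < τ 0 + τ 1 := by
    refine lt_of_le_of_ne (add_nonneg (hτ 0) (hτ 1)) fun h => hτ0 ?_
    have h0 := hτ 0
    have h1 := hτ 1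
    ext i
    fin_cases i
    · simp only [Fin.zero_eta, Pi.zero_apply]; linarith
    · simp only [Fin.mk_one, Pi.zero_apply]; linarith
  have hcl (q : ℕ) := tendsto_measureReal_clusterSet hε hx0 hx q
  have htail : HasTailLimit volume catMap (observable ε g) u (gammaHat τ) := by
    have h := hcl 0
    simp only [clusterSet_zero, clusterArea_zero_eq hε, ← hU] at h
    exact h
  refine ⟨htail, ⟨fun _ => gapLength, mixingCondition hε hx0 hx hU,
    separationCondition hε hx0 hx hU⟩, ?_, ?_⟩
  · refine ⟨fun q => clusterArea ε q (τ 0 / segWeight ε 0) (τ 1 / segWeight ε 1) / gammaHat τ,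
      fun q => ?_, ?_⟩
    · have h := (hcl q).div htail hΓ.ne'
      refine h.congr' ?_
      filter_upwards [eventually_ge_atTop 1] with n hn
      have hn0 : (n : ℝ) ≠ 0 := by positivity
      simp only [Pi.div_apply]
      rw [mul_div_mul_left _ _ hn0, clusterEnd_eq, clusterEnd_eq, clusterSet_zero, hU]
    -- The inner limits are constant from `q = 2` on.
    · refine tendsto_const_nhds.congr' ?_
      filter_upwards [eventually_ge_atTop 2] with q hq
      rw [clusterArea_eq_theta hε hΓ hq, mul_div_cancel_right₀ _ (show gammaHat τ ≠ 0 from hΓ.ne')]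
  · have h := tendsto_measureReal_avoid hε hx0 hx
    rw [clusterArea_eq_theta hε hΓ (by norm_num)] at h
    refine h.congr fun n => ?_
    rw [maxLE_eq, hU]
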